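/- A linear equation of length $k$ is an equation $a_1x_1+\dots+a_kx_k=b$ with $a_1,\dots,a_k\in\mathbb Z\setminus\{0\}$ and $b\in\mathbb Z$ (so $b\neq 0$ is allowed); its underlying matrix is the $1\times k$ matrix $(a_1\ \cdots\ a_k)$. A $k$-distinct solution of the equation in a set $S\subseteq\mathbb Z$ is a solution $(x_1,\dots,x_k)\in S^k$ with $x_1,\dots,x_k$ pairwise distinct. The equation is irredundant if it has a $k$-distinct solution in the positive integers, and its underlying matrix is irredundant if the homogeneous equation $a_1x_1+\dots+a_kx_k=0$ has one. For linear equations $A,B$ of lengths $k_A,k_B$, a set $S\subseteq\mathbb Z$ is $(A,B)$-Rado if every colouring of the elements of $S$ with the colours red and blue yields a $k_A$-distinct solution of $A$ in $S$ all of whose entries are red, or a $k_B$-distinct solution of $B$ in $S$ all of whose entries are blue. Finally, $[n]_p$ denotes the random subset of $\{1,\dots,n\}$ that contains each element independently with probability $p$. Theorem. Let $k_B\geq k_A\geq 3$ be integers. Then there exists a constant $c>0$, depending only on $k_A$ and $k_B$, such that the following holds. Let $A$ and $B$ be linear equations of lengths $k_A$ and $k_B$ respectively such that $A$, $B$ and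 their underlying matrices are all irredundant, and let $p=p(n)\in[0,1]$. If $$p(n)\leq c\,n^{-\frac{k_Ak_B-k_A-k_B}{k_Ak_B-k_A}}$$ for all sufficiently large $n$, then $$\lim_{n\to\infty}\mathbb P\big[\,[n]_{p(n)}\text{ is }(A,B)\text{-Rado}\,\big]=0.$$ -/

import Mathlib

open Filter Topology ProbabilityTheory

/-- A linear equation `a₁ x₁ + ⋯ + aₖ xₖ = b` of length `k`, with integer coefficients, all of the
`aᵢ` being nonzero. It may be inhomogeneous (`b ≠ 0`). -/
structure LinearEquation (k : ℕ) where
  /-- The coefficients `a₁, …, aₖ`. -/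
  coeff : Fin k → ℤ
  /-- All coefficients are nonzero. -/
  coeff_ne_zero : ∀ i, coeff i ≠ 0
  /-- The right-hand side `b`. -/
  rhs : ℤ

namespace LinearEquation

/-- The underlying `1 × k` matrix `(a₁ ⋯ aₖ)` of a linear equation. -/
def underlyingMatrix {k : ℕ} (A : LinearEquation k) : Matrix (Fin 1) (Fin k) ℤ :=
  Matrix.of fun _ i => A.coeff i

/-- `x` is a `k`-distinct solution of `A`: it solves the equation and its entries are pairwise
distinct. -/
def IsDistinctSolution {k : ℕ} (A : LinearEquation k) (x : Fin k → ℤ) : Prop :=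
  ∑ i, A.coeff i * x i = A.rhs ∧ Function.Injective x

/-- `A` is irredundant: it has a `k`-distinct solution in the positive integers. -/
def Irredundant {k : ℕ} (A : LinearEquation k) : Prop :=
  ∃ x : Fin k → ℤ, (∀ i, 0 < x i) ∧ A.IsDistinctSolution x

end LinearEquation

/-- An integer matrix `M` with `k` columns is irredundant if `M x = 0` has a solution in the
positive integers with pairwise distinct entries. -/
def MatrixIrredundant {l k : ℕ} (M : Matrix (Fin l) (Fin k) ℤ) : Prop :=
  ∃ x : Fin k → ℤ, (∀ i, 0 < x i) ∧ Function.Injective x ∧ M.mulVec x = 0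

/-- The two colours. -/
inductive Colour
  | red
  | blue

/-- A set `S` of integers is `(A, B)`-Rado if every red/blue colouring of `S` has a red
`kA`-distinct solution of `A` in `S` or a blue `kB`-distinct solution of `B` in `S`. -/
def IsRado {kA kB : ℕ} (A : LinearEquation kA) (B : LinearEquation kB) (S : Set ℤ) : Prop :=
  ∀ χ : S → Colour,
    (∃ x : Fin kA → S, A.IsDistinctSolution (fun i => (x i : ℤ)) ∧ ∀ i, χ (x i) = .red) ∨
    (∃ y : Fin kB → S, B.IsDistinctSolution (fun i => (y i : ℤ)) ∧ ∀ i, χ (y i) = .blue)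

/-- The law of the binomial random set `[n]_p`: each element of `{1, …, n}` is included
independently with probability `p`, and no other integer is. -/
noncomputable def randomSubset (n : ℕ) (p : unitInterval) : MeasureTheory.Measure (Set ℤ) :=
  setBernoulli (Set.Icc (1 : ℤ) n) p

/-!
If a finite set is Rado, then the solution sets that it contains, with those of `A` to be avoided in
red and those of `B` to be avoided in blue, contain a minimal uncolourable pair of families. By
minimality, through every vertex of an edge passes an edge of the other family meeting it in that
vertex only. Starting from a solution of `A`, one can therefore keep attaching crowns, each made of
a solution of `B` through a known vertex and of solutions of `A` through its new vertices; for
`kA = kB = 3` single triples play this role.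

A set of `m` integers contains all entries but one of only polynomially many (in `m`) solutions, so
each new solution costs a vertex that is determined up to few choices. At the threshold, attaching a
crown at a single known vertex thus has exponent `0` in `n`, and it multiplies the expected number
of configurations by a factor at most `1 / 2` once `c` is small. The walk either lasts for `log₂ n`
steps, which makes the expected number of configurations tend to `0`, or runs into an attachment of
another kind. Each of these lowers the exponent, and at most two of them make it negative. Only
polylogarithmically many shapes of configurations occur, and a union bound concludes. When
`kA = kB = 3`, the exponent may fail to become negative for a linear system of triples on six
vertices; such a system is `2`-colourable, so it does not arise.
-/

open Finset

/-! ### Uncolourable pairs of hypergraphs -/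

section Uncolourable

variable {α : Type*}

/-- The pair `(FA, FB)` of hypergraphs is uncolourable: every colouring of the vertices, given by
its set `C` of red vertices, has a red edge of `FA` or a blue edge of `FB`. -/
def IsUncolourable (FA FB : Finset (Finset α)) : Prop :=
  ∀ C : Set α, (∃ e ∈ FA, (e : Set α) ⊆ C) ∨ ∃ f ∈ FB, (f : Set α) ⊆ Cᶜ

/-- An uncolourable pair of hypergraphs which is minimal for inclusion on both sides. -/
def IsMinimalUncolourable (FA FB : Finset (Finset α)) : Prop :=
  Minimal (fun F : Finset (Finset α) × Finset (Finset α) => IsUncolourable F.1 F.2) (FA, FB)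

variable {FA FB : Finset (Finset α)}

namespace IsUncolourable

lemma symm (h : IsUncolourable FA FB) : IsUncolourable FB FA := fun C => by
  simpa only [compl_compl] using (h Cᶜ).symm

lemma exists_minimal (h : IsUncolourable FA FB) :
    ∃ GA ⊆ FA, ∃ GB ⊆ FB, IsMinimalUncolourable GA GB := by
  obtain ⟨⟨GA, GB⟩, hle, hmin⟩ := exists_minimal_le_of_wellFoundedLT
    (fun F : Finset (Finset α) × Finset (Finset α) => IsUncolourable F.1 F.2) (FA, FB) h
  exact ⟨GA, hle.1, GB, hle.2, hmin⟩

lemma nonempty_left (h : IsUncolourable FA FB) (hB : ∀ f ∈ FB, f.Nonempty) : FA.Nonempty := by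
  rcases h Set.univ with ⟨e, he, -⟩ | ⟨f, hf, hfC⟩
  · exact ⟨e, he⟩
  · obtain ⟨x, hx⟩ := hB f hf
    exact absurd (Set.mem_univ x) (hfC hx)

end IsUncolourable

namespace IsMinimalUncolourable

lemma isUncolourable (h : IsMinimalUncolourable FA FB) : IsUncolourable FA FB :=
  h.prop

lemma symm (h : IsMinimalUncolourable FA FB) : IsMinimalUncolourable FB FA :=
  ⟨h.isUncolourable.symm, fun G hG hle =>
    (h.le_of_le (y := G.swap) hG.symm ⟨hle.2, hle.1⟩).symm⟩

lemma exists_colouring_of_lt (h : IsMinimalUncolourable FA FB) {GA GB : Finset (Finset α)}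
    (hlt : (GA, GB) < (FA, FB)) :
    ∃ C : Set α, (∀ e ∈ GA, ¬ (e : Set α) ⊆ C) ∧ ∀ f ∈ GB, ¬ (f : Set α) ⊆ Cᶜ := by
  have hcol : ¬ IsUncolourable GA GB := h.not_prop_of_lt hlt
  simpa only [IsUncolourable, not_forall, not_or, not_exists, not_and] using hcol

variable [DecidableEq α]

-- Colour everything but `e` well. Then `e` is red, and recolouring its vertex `x` blue creates a
-- blue edge, which meets `e` in `x` only.
lemma exists_inter_eq_singleton (h : IsMinimalUncolourable FA FB) {e : Finset α} (he : e ∈ FA)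
    {x : α} (hx : x ∈ e) : ∃ f ∈ FB, e ∩ f = {x} := by
  obtain ⟨C, hCA, hCB⟩ := h.exists_colouring_of_lt (GA := FA.erase e) (GB := FB)
    (Prod.mk_lt_mk_iff_left.2 (erase_ssubset he))
  have heC : (e : Set α) ⊆ C := by
    rcases h.isUncolourable C with ⟨e', he', hC⟩ | ⟨f, hf, hC⟩
    · by_cases hee : e' = e
      · exact hee ▸ hC
      · exact absurd hC (hCA e' (mem_erase.2 ⟨hee, he'⟩))
    · exact absurd hC (hCB f hf)
  rcases h.isUncolourable (C \ {x}) with ⟨e', he', hC⟩ | ⟨f, hf, hC⟩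
  · refine absurd (hC.trans Set.sdiff_subset) (hCA e' (mem_erase.2 ⟨?_, he'⟩))
    rintro rfl
    exact (hC hx).2 rfl
  · have hfx : ∀ z ∈ f, z ∈ C → z = x := fun z hz hzC =>
      by_contra fun hzx => hC hz ⟨hzC, hzx⟩
    obtain ⟨z, hzf, hzC⟩ := Set.not_subset.1 (hCB f hf)
    have hxf : x ∈ f := hfx z hzf (not_not.1 hzC) ▸ hzf
    refine ⟨f, hf, eq_singleton_iff_unique_mem.2 ⟨mem_inter.2 ⟨hx, hxf⟩, fun z hz => ?_⟩⟩
    exact hfx z (mem_inter.1 hz).2 (heC (mem_inter.1 hz).1)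

-- Otherwise the edges inside `Z` and those outside of `Z` could be coloured separately.
lemma subset_of_closed (h : IsMinimalUncolourable FA FB) {Z : Finset α}
    (hZ : ∀ g ∈ FA ∪ FB, g ⊆ Z ∨ Disjoint g Z) (hin : ∃ g ∈ FA ∪ FB, g ⊆ Z)
    {g : Finset α} (hg : g ∈ FA ∪ FB) : g ⊆ Z := by
  by_contra hgZ
  have hlt : ∀ p : Finset α → Prop, ∀ [DecidablePred p], (∃ g' ∈ FA ∪ FB, ¬ p g') →
      (FA.filter p, FB.filter p) < (FA, FB) := by
    rintro p _ ⟨g', hg', hpg⟩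
    refine lt_of_le_of_ne ⟨filter_subset _ _, filter_subset _ _⟩ fun heq => ?_
    rw [Prod.mk.injEq, filter_eq_self, filter_eq_self] at heq
    exact hpg ((mem_union.1 hg').elim (heq.1 g') (heq.2 g'))
  obtain ⟨C, hCA, hCB⟩ := h.exists_colouring_of_lt (hlt (· ⊆ Z) ⟨g, hg, hgZ⟩)
  obtain ⟨C', hCA', hCB'⟩ := h.exists_colouring_of_lt (hlt (¬ · ⊆ Z) (by simpa using hin))
  simp only [mem_filter, and_imp, Set.subset_def, mem_coe, Set.mem_compl_iff] at hCA hCB hCA' hCB'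
  have hdisj : ∀ g' ∈ FA ∪ FB, ¬ g' ⊆ Z → ∀ z ∈ g', z ∉ Z := fun g' hg' hgZ' =>
    fun z hz => disjoint_left.1 ((hZ g' hg').resolve_left hgZ') hz
  rcases h.isUncolourable ((C ∩ Z) ∪ (C' \ Z)) with ⟨e, he, hC⟩ | ⟨f, hf, hC⟩
  · by_cases heZ : e ⊆ Z
    · exact hCA e he heZ fun z hz => ((hC hz).resolve_right fun h => h.2 (heZ hz)).1
    · exact hCA' e he heZ fun z hz => ((hC hz).resolve_left fun h =>
        hdisj e (mem_union_left _ he) heZ z hz h.2).1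
  · by_cases hfZ : f ⊆ Z
    · exact hCB f hf hfZ fun z hz hzC => hC hz (.inl ⟨hzC, hfZ hz⟩)
    · exact hCB' f hf hfZ fun z hz hzC =>
        hC hz (.inr ⟨hzC, hdisj f (mem_union_right _ hf) hfZ z hz⟩)

end IsMinimalUncolourable

end Uncolourable

/-! ### Chains of edges -/

section Chains

variable {α : Type*}

/-- `ChainRank E R X k` says that inside `X ⊇ R` there are `k` edges (sets satisfying `E`), listed
in such a way that each of them has a vertex outside of `R` and of all the preceding ones. -/
inductive ChainRank (E : Finset α → Prop) (R : Finset α) : Finset α → ℕ → Prop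
  | zero {X : Finset α} : R ⊆ X → ChainRank E R X 0
  | succ {X X' g : Finset α} {k : ℕ} : ChainRank E R X k → X ⊆ X' → E g → g ⊆ X' → ¬ g ⊆ X →
      ChainRank E R X' (k + 1)

namespace ChainRank

variable {E : Finset α → Prop} {R X Y g : Finset α} {k : ℕ}

lemma base_subset (h : ChainRank E R X k) : R ⊆ X := by
  induction h with
  | zero h => exact h
  | succ _ h _ _ _ ih => exact ih.trans h

lemma mono (h : ChainRank E R X k) (hXY : X ⊆ Y) : ChainRank E R Y k := by
  cases h with
  | zero h => exact .zero (h.trans hXY)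
  | succ h hX hg hgX hgX' => exact .succ h (hX.trans hXY) hg (hgX.trans hXY) hgX'

lemma single (hg : E g) (hne : g.Nonempty) : ChainRank E ∅ g 1 :=
  .succ (.zero subset_rfl) (empty_subset g) hg subset_rfl fun h => hne.ne_empty (subset_empty.1 h)

variable [DecidableEq α]

lemma add_edge (h : ChainRank E R X k) (hg : E g) (hgX : ¬ g ⊆ X) :
    ChainRank E R (X ∪ g) (k + 1) :=
  .succ h subset_union_left hg subset_union_right hgX

lemma exists_erase (h : ChainRank E R X (k + 1)) :
    ∃ t ∈ X, t ∉ R ∧ ChainRank E R (X.erase t) k ∧ ∃ g, E g ∧ t ∈ g ∧ g ⊆ X := by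
  cases h with
  | succ h hX hg hgX hgX' =>
    obtain ⟨t, htg, htX⟩ := not_subset.1 hgX'
    exact ⟨t, hgX htg, fun htR => htX (h.base_subset htR),
      h.mono fun x hx => mem_erase.2 ⟨fun hxt => htX (hxt ▸ hx), hX hx⟩, _, hg, htg, hgX⟩

lemma le_card_sdiff (h : ChainRank E R X k) : k ≤ #(X \ R) := by
  induction k generalizing X with
  | zero => exact Nat.zero_le _
  | succ k ih =>
    obtain ⟨t, htX, htR, h', -⟩ := h.exists_erase
    have htXR : t ∈ X \ R := mem_sdiff.2 ⟨htX, htR⟩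
    have hk : k ≤ #((X \ R).erase t) := by simpa only [erase_sdiff_comm] using ih h'
    rw [card_erase_of_mem htXR] at hk
    have := card_pos.2 ⟨t, htXR⟩
    omega

lemma biUnion {U : Finset α} {e : α → Finset α} (hE : ∀ x ∈ U, E (e x)) (hmem : ∀ x ∈ U, x ∈ e x)
    (hR : ∀ x ∈ U, x ∉ R) (huniq : ∀ x ∈ U, ∀ x' ∈ U, x ∈ e x' → x = x') :
    ChainRank E R (R ∪ U.biUnion e) #U := by
  induction U using Finset.induction_on with
  | empty => exact .zero (by simp)
  | insert x U hx ih =>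
    simp only [forall_mem_insert] at hE hmem hR huniq
    have hchain := ih hE.2 hmem.2 hR.2 fun y hy z hz => (huniq.2 y hy).2 z hz
    rw [card_insert_of_notMem hx]
    refine (hchain.add_edge hE.1 fun hsub => ?_).mono (by rw [biUnion_insert]; grind)
    rcases mem_union.1 (hsub hmem.1) with hxR | hxU
    · exact hR.1 hxR
    · obtain ⟨z, hz, hxz⟩ := mem_biUnion.1 hxU
      exact hx (huniq.1.2 z hz hxz ▸ hz)

end ChainRank

/-- `T ⊆ S` is an extension of `W`: it is disjoint from `W`, has at most `D` elements, and `W ∪ T`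
has a chain of `k` edges over `W`. -/
structure IsExtension [DecidableEq α] (E : Finset α → Prop) (S : Finset α) (D : ℕ)
    (W T : Finset α) (k : ℕ) : Prop where
  subset : T ⊆ S
  disjoint : Disjoint W T
  card_le : #T ≤ D
  chainRank : ChainRank E W (W ∪ T) k

namespace IsExtension

variable [DecidableEq α] {E : Finset α → Prop} {S W T : Finset α} {D k : ℕ}

lemma of_empty (hTS : T ⊆ S) (hT : #T ≤ D) (hk : ChainRank E ∅ T k) : IsExtension E S D ∅ T k :=
  ⟨hTS, disjoint_empty_left T, hT, by rwa [empty_union]⟩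

lemma edges_le_card (h : IsExtension E S D W T k) : k ≤ #T := by
  simpa only [union_sdiff_cancel_left h.disjoint] using h.chainRank.le_card_sdiff

end IsExtension

end Chains

/-! ### Explorations -/

section Explorations

variable {α : Type*} [DecidableEq α]

open Classical in
/-- The `N`-element subsets `T` of `V` such that `R ∪ T` has a chain of `k` edges over `R`. -/
noncomputable def extensions (E : Finset α → Prop) (V R : Finset α) (N k : ℕ) :
    Finset (Finset α) :=
  (V.powersetCard N).filter fun T => ChainRank E R (R ∪ T) k

lemma mem_extensions {E : Finset α → Prop} {V R T : Finset α} {N k : ℕ} :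
    T ∈ extensions E V R N k ↔ T ⊆ V ∧ #T = N ∧ ChainRank E R (R ∪ T) k := by
  simp only [extensions, mem_filter, mem_powersetCard, and_assoc]

/-- All the ways to enlarge a set of a family of sets with a marked point by a disjoint set, taken
from `X`, and to choose a new marked point, taken from `Y`. -/
def attachAll (X : Finset α × α → Finset (Finset α)) (Y : Finset α × α → Finset α → Finset α)
    (𝓕 : Finset (Finset α × α)) : Finset (Finset α × α) :=
  𝓕.biUnion fun s => ((X s).filter (Disjoint s.1)).biUnion fun T =>
    (Y s T).image fun y => (s.1 ∪ T, y)

/-- All the ways to enlarge the sets of a family by extensions attached anywhere to them. -/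
noncomputable def globalStep (E : Finset α → Prop) (V : Finset α) (N k : ℕ) :
    Finset (Finset α × α) → Finset (Finset α × α) :=
  attachAll (fun s => extensions E V s.1 N k) fun s T => insert s.2 (s.1 ∪ T)

/-- All the ways to enlarge the sets of a family by extensions attached at the marked point only,
the new marked point being chosen in the extension. -/
noncomputable def localStep (E : Finset α → Prop) (V : Finset α) (N k : ℕ) :
    Finset (Finset α × α) → Finset (Finset α × α) :=
  attachAll (fun s => extensions E V {s.2} N k) fun _ T => T

lemma mem_attachAll {X : Finset α × α → Finset (Finset α)}
    {Y : Finset α × α → Finset α → Finset α} {𝓕 : Finset (Finset α × α)} {t : Finset α × α} :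
    t ∈ attachAll X Y 𝓕 ↔
      ∃ s ∈ 𝓕, ∃ T ∈ X s, Disjoint s.1 T ∧ ∃ y ∈ Y s T, (s.1 ∪ T, y) = t := by
  simp only [attachAll, mem_biUnion, mem_filter, mem_image, and_assoc]

/-- One stage of an exploration: a global step adding `size` vertices and `edges` edges, followed
by `len` local steps. -/
structure Stage where
  size : ℕ
  edges : ℕ
  len : ℕ

/-- The numerical parameters of an exploration. A local step adds `stepSize` vertices and
`stepEdges` edges, the stages have size at most `maxSize`. The random set has about
`n ^ (density - 1) * n` elements, so that an exploration with `N` vertices and `k` edges has weight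
about `n ^ (density * N - k)`; a long exploration may have an exponent up to `slack`. -/
structure Scheme where
  stepSize : ℕ
  stepEdges : ℕ
  maxSize : ℕ
  density : ℝ
  slack : ℝ

/-- The exponent of `n` contributed by the global steps of an exploration. -/
def stageExponent (P : Scheme) (l : List Stage) : ℝ :=
  (l.map fun σ => P.density * σ.size - σ.edges).sum

lemma stageExponent_nil (P : Scheme) : stageExponent P [] = 0 := rfl

lemma stageExponent_cons (P : Scheme) (σ : Stage) (l : List Stage) :
    stageExponent P (σ :: l) = P.density * σ.size - σ.edges + stageExponent P l :=
  List.sum_cons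

/-- The number of local steps of an exploration. -/
def stageLength (l : List Stage) : ℕ :=
  (l.map Stage.len).sum

lemma stageLength_cons (σ : Stage) (l : List Stage) :
    stageLength (σ :: l) = σ.len + stageLength l :=
  List.sum_cons

variable [Inhabited α]

/-- The sets with a marked point produced by the explorations whose stages, from the last one to
the first one, are those of a list. Explorations start from the empty set, the first marked point
being irrelevant. -/
noncomputable def explorations (P : Scheme) (E : Finset α → Prop) (V : Finset α) :
    List Stage → Finset (Finset α × α)
  | [] => {(∅, default)}
  | σ :: l => (localStep E V P.stepSize P.stepEdges)^[σ.len]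
      (globalStep E V σ.size σ.edges (explorations P E V l))

/-- The number of vertices and edges of the stages are at most `P.maxSize`, and their lengths are at
most `L`. -/
def IsBoundedBy (P : Scheme) (L : ℕ) (l : List Stage) : Prop :=
  ∀ σ ∈ l, σ.size ≤ P.maxSize ∧ σ.edges ≤ P.maxSize ∧ σ.len ≤ L

/-- `s` is the outcome of an exploration with stages `l` which takes place inside of `S ⊆ V`. -/
structure IsExplored (P : Scheme) (E : Finset α → Prop) (V : Finset α) (L : ℕ) (S : Finset α)
    (l : List Stage) (s : Finset α × α) : Prop where
  mem : s ∈ explorations P E V l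
  subset : s.1 ⊆ S
  bounded : IsBoundedBy P L l

/-- `S` contains the outcome of an exploration with at most three stages which is either too dense
or too long to be expected in the random set. -/
def HasRareExploration (P : Scheme) (E : Finset α → Prop) (V : Finset α) (L : ℕ)
    (S : Finset α) : Prop :=
  ∃ l : List Stage, ∃ s, l.length ≤ 3 ∧ IsExplored P E V L S l s ∧
    (stageExponent P l < 0 ∨ stageExponent P l ≤ P.slack ∧ L ≤ stageLength l)

/-- `T ⊆ S` extends `W` at its marked point `y` by a local step with new marked point `y'`. -/
structure IsLocalExtension (P : Scheme) (E : Finset α → Prop) (S W : Finset α) (y : α)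
    (T : Finset α) (y' : α) : Prop where
  subset : T ⊆ S
  disjoint : Disjoint W T
  mem : y' ∈ T
  card_eq : #T = P.stepSize
  chainRank : ChainRank E {y} ({y} ∪ T) P.stepEdges

variable {P : Scheme} {E : Finset α → Prop} {V S W T : Finset α} {L k N i : ℕ} {l : List Stage}
  {s : Finset α × α} {y y' : α}

namespace IsExplored

lemma nil (hS : (∅ : Finset α) ⊆ S) : IsExplored P E V L S [] (∅, default) :=
  ⟨mem_singleton_self _, hS, List.forall_mem_nil _⟩

lemma attach (h : IsExplored P E V L S l s) (hSV : S ⊆ V)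
    (hT : IsExtension E S P.maxSize s.1 T k) (hy : y ∈ insert s.2 (s.1 ∪ T)) :
    IsExplored P E V L S (⟨#T, k, 0⟩ :: l) (s.1 ∪ T, y) where
  mem := mem_attachAll.2 ⟨s, h.mem, T, mem_extensions.2 ⟨hT.subset.trans hSV, rfl, hT.chainRank⟩,
    hT.disjoint, y, hy, rfl⟩
  subset := union_subset h.subset hT.subset
  bounded := List.forall_mem_cons.2
    ⟨⟨hT.card_le, hT.edges_le_card.trans hT.card_le, L.zero_le⟩, h.bounded⟩

lemma local_step (h : IsExplored P E V L S (⟨N, k, i⟩ :: l) s) (hSV : S ⊆ V) (hi : i < L)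
    (hT : IsLocalExtension P E S s.1 s.2 T y') :
    IsExplored P E V L S (⟨N, k, i + 1⟩ :: l) (s.1 ∪ T, y') where
  mem := by
    rw [explorations, Function.iterate_succ_apply']
    exact mem_attachAll.2 ⟨s, h.mem, T, mem_extensions.2 ⟨hT.subset.trans hSV, hT.card_eq,
      hT.chainRank⟩, hT.disjoint, y', hT.mem, rfl⟩
  subset := union_subset h.subset hT.subset
  bounded := by
    have hb := List.forall_mem_cons.1 h.bounded
    exact List.forall_mem_cons.2 ⟨⟨hb.1.1, hb.1.2.1, hi⟩, hb.2⟩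

lemma exists_walk {Inv Halt : Finset α → α → Prop} (hSV : S ⊆ V)
    (hstep : ∀ W y, Inv W y →
      Halt W y ∨ ∃ T y', IsLocalExtension P E S W y T y' ∧ Inv (W ∪ T) y')
    (h : IsExplored P E V L S (⟨N, k, 0⟩ :: l) s) (hs : Inv s.1 s.2) :
    ∃ i s', IsExplored P E V L S (⟨N, k, i⟩ :: l) s' ∧ (i = L ∨ Halt s'.1 s'.2) := by
  by_contra! hcon
  have hwalk : ∀ j ≤ L, ∃ s', IsExplored P E V L S (⟨N, k, j⟩ :: l) s' ∧ Inv s'.1 s'.2 := by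
    intro j hj
    induction j with
    | zero => exact ⟨s, h, hs⟩
    | succ j ih =>
      obtain ⟨s', hs', hinv⟩ := ih (by omega)
      obtain ⟨T, y', hT, hinv'⟩ := (hstep _ _ hinv).resolve_left (hcon j s' hs').2
      exact ⟨_, hs'.local_step hSV hj hT, hinv'⟩
  obtain ⟨s', hs', -⟩ := hwalk L le_rfl
  exact (hcon L s' hs').1 rfl

end IsExplored

lemma hasRareExploration_of_dense (hSV : S ⊆ V) (hT : IsExtension E S P.maxSize ∅ T k)
    (hneg : P.density * #T - k < 0) : HasRareExploration P E V L S :=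
  ⟨_, _, by simp, (IsExplored.nil (empty_subset S)).attach hSV hT (mem_insert_self _ _),
    .inl (by simpa [stageExponent] using hneg)⟩

end Explorations

/-! ### Crowns -/

section Crowns

variable {α : Type*} [DecidableEq α]

/-- A crown over `W` inside of `S`: an edge `f` together with `a`-element edges `e x` through its
vertices `x` outside of `W`, each of which meets `f` in `x` only. -/
structure IsCrown (E : Finset α → Prop) (S : Finset α) (a : ℕ) (W f : Finset α)
    (e : α → Finset α) : Prop where
  isEdge_base : E f
  base_subset : f ⊆ S
  isEdge : ∀ x ∈ f \ W, E (e x)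
  subset : ∀ x ∈ f \ W, e x ⊆ S
  card_eq : ∀ x ∈ f \ W, #(e x) = a
  inter_eq : ∀ x ∈ f \ W, e x ∩ f = {x}

/-- The vertices outside of `W` of a crown over `W`. -/
def crownVertices (W f : Finset α) (e : α → Finset α) : Finset α :=
  (f ∪ (f \ W).biUnion e) \ W

/-- The vertices of the edge `e x` of a crown over `W` which are neither in `W` nor in another edge
of the crown. -/
def privateVertices (W f : Finset α) (e : α → Finset α) (x : α) : Finset α :=
  e x \ (W ∪ ((f \ W).erase x).biUnion e ∪ f)

lemma union_crownVertices (W f : Finset α) (e : α → Finset α) :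
    W ∪ crownVertices W f e = W ∪ (f ∪ (f \ W).biUnion e) :=
  union_sdiff_self_eq_union

lemma sdiff_subset_crownVertices (W f : Finset α) (e : α → Finset α) :
    f \ W ⊆ crownVertices W f e :=
  sdiff_subset_sdiff subset_union_left subset_rfl

lemma privateVertices_subset_crownVertices {W f : Finset α} {e : α → Finset α} {x : α}
    (hx : x ∈ f \ W) : privateVertices W f e x ⊆ crownVertices W f e := by
  have := subset_biUnion_of_mem e hx
  unfold privateVertices crownVertices
  grind

namespace IsCrown

variable {E : Finset α → Prop} {S R W f f' : Finset α} {a : ℕ} {e : α → Finset α} {x t x₀ y z : α}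

lemma mem_edge (h : IsCrown E S a W f e) (hx : x ∈ f \ W) : x ∈ e x :=
  (mem_inter.1 ((h.inter_eq x hx).symm ▸ mem_singleton_self x)).1

lemma eq_of_mem (h : IsCrown E S a W f e) (hx : x ∈ f \ W) (ht : t ∈ f) (htx : t ∈ e x) : t = x :=
  mem_singleton.1 (h.inter_eq x hx ▸ mem_inter.2 ⟨htx, ht⟩)

lemma chainRank_biUnion (h : IsCrown E S a W f e) {U : Finset α} (hU : U ⊆ f \ W) (hR : R ⊆ W) :
    ChainRank E R (R ∪ U.biUnion e) #U :=
  .biUnion (fun x hx => h.isEdge x (hU hx)) (fun _ hx => h.mem_edge (hU hx))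
    (fun _ hx hxR => (mem_sdiff.1 (hU hx)).2 (hR hxR))
    fun _ hx _ hx' => h.eq_of_mem (hU hx') (mem_sdiff.1 (hU hx)).1

lemma chainRank_erase (h : IsCrown E S a W f e) (hR : R ⊆ W) (hx₀ : x₀ ∈ f \ W) :
    ChainRank E R (R ∪ ((f \ W).erase x₀).biUnion e ∪ f) #(f \ W) := by
  have hchain := (h.chainRank_biUnion (erase_subset x₀ _) hR).add_edge h.isEdge_base fun hsub => by
    rcases mem_union.1 (hsub (mem_sdiff.1 hx₀).1) with hxR | hxU
    · exact (mem_sdiff.1 hx₀).2 (hR hxR)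
    · obtain ⟨x, hx, hxx⟩ := mem_biUnion.1 hxU
      exact ne_of_mem_erase hx
        (h.eq_of_mem (mem_of_mem_erase hx) (mem_sdiff.1 hx₀).1 hxx).symm
  rwa [card_erase_add_one hx₀] at hchain

lemma chainRank_of_private (h : IsCrown E S a W f e) (hR : R ⊆ W) (hx₀ : x₀ ∈ f \ W)
    (hy : y ∈ privateVertices W f e x₀) :
    ChainRank E R (R ∪ (f ∪ (f \ W).biUnion e)) (#(f \ W) + 1) := by
  obtain ⟨hye, hyW⟩ := mem_sdiff.1 hy
  refine ((h.chainRank_erase hR hx₀).add_edge (h.isEdge x₀ hx₀) fun hsub => hyW ?_).mono ?_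
  · exact union_subset_union_left (union_subset_union_left hR) (hsub hye)
  · have herase := biUnion_subset_biUnion_of_subset_left e (erase_subset x₀ (f \ W))
    have hmem := subset_biUnion_of_mem e hx₀
    grind

-- The edge `f'` goes before `e x₀`, which still has `z` to itself.
lemma chainRank_of_private_pair (h : IsCrown E S a W f e) (hx₀ : x₀ ∈ f \ W)
    (hy : y ∈ privateVertices W f e x₀) (hz : z ∈ privateVertices W f e x₀) (hzy : z ≠ y)
    (hf' : E f') (hinter : e x₀ ∩ f' = {y}) (hsub : f' ⊆ W ∪ crownVertices W f e) :
    ChainRank E W (W ∪ crownVertices W f e) (#(f \ W) + 2) := by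
  have hyf' : y ∈ f' := (mem_inter.1 (hinter.symm ▸ mem_singleton_self y)).2
  obtain ⟨hze, hzW⟩ := mem_sdiff.1 hz
  refine (((h.chainRank_erase subset_rfl hx₀).add_edge hf'
    fun hf'W => (mem_sdiff.1 hy).2 (hf'W hyf')).add_edge (h.isEdge x₀ hx₀) fun heW => ?_).mono ?_
  · rcases mem_union.1 (heW hze) with hz' | hz'
    · exact hzW hz'
    · exact hzy (mem_singleton.1 (hinter ▸ mem_inter.2 ⟨hze, hz'⟩))
  · rw [union_crownVertices] at hsub ⊢
    have herase := biUnion_subset_biUnion_of_subset_left e (erase_subset x₀ (f \ W))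
    have hmem := subset_biUnion_of_mem e hx₀
    grind

lemma crownVertices_subset_biUnion (h : IsCrown E S a W f e) :
    crownVertices W f e ⊆ (f \ W).biUnion fun x => e x \ W := by
  intro t ht
  obtain ⟨htf | hte, htW⟩ := (mem_sdiff.1 ht).imp_left mem_union.1
  · have htU : t ∈ f \ W := mem_sdiff.2 ⟨htf, htW⟩
    exact mem_biUnion.2 ⟨t, htU, mem_sdiff.2 ⟨h.mem_edge htU, htW⟩⟩
  · obtain ⟨x, hx, htx⟩ := mem_biUnion.1 hte
    exact mem_biUnion.2 ⟨x, hx, mem_sdiff.2 ⟨htx, htW⟩⟩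

lemma card_edge_sdiff_le (h : IsCrown E S a W f e) (hx : x ∈ f \ W) : #(e x \ W) ≤ a :=
  (card_le_card sdiff_subset).trans (h.card_eq x hx).le

lemma sum_card_sdiff_le (h : IsCrown E S a W f e) : ∑ x ∈ f \ W, #(e x \ W) ≤ #(f \ W) * a :=
  sum_le_card_nsmul _ _ _ fun _ => h.card_edge_sdiff_le

lemma sum_card_sdiff_lt (h : IsCrown E S a W f e) (hx : x ∈ f \ W) (hmeet : ¬ Disjoint (e x) W) :
    ∑ x ∈ f \ W, #(e x \ W) < #(f \ W) * a := by
  rw [← smul_eq_mul, ← sum_const]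
  refine sum_lt_sum (fun _ => h.card_edge_sdiff_le) ⟨x, hx, ?_⟩
  rw [← h.card_eq x hx]
  exact card_lt_card
    (sdiff_subset.ssubset_of_ne fun heq => hmeet (sdiff_eq_self_iff_disjoint.1 heq))

lemma card_crownVertices_le_sum (h : IsCrown E S a W f e) :
    #(crownVertices W f e) ≤ ∑ x ∈ f \ W, #(e x \ W) :=
  (card_le_card h.crownVertices_subset_biUnion).trans card_biUnion_le

lemma card_crownVertices_le (h : IsCrown E S a W f e) : #(crownVertices W f e) ≤ #(f \ W) * a :=
  h.card_crownVertices_le_sum.trans h.sum_card_sdiff_le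

lemma disjoint_of_card_eq (h : IsCrown E S a W f e) (hcard : #(crownVertices W f e) = #(f \ W) * a)
    (hx : x ∈ f \ W) : Disjoint (e x) W :=
  not_not.1 fun hmeet =>
    (h.card_crownVertices_le_sum.trans_lt (h.sum_card_sdiff_lt hx hmeet)).ne hcard

lemma crownVertices_eq_biUnion (h : IsCrown E S a W f e) (hd : ∀ x ∈ f \ W, Disjoint (e x) W) :
    crownVertices W f e = (f \ W).biUnion e := by
  refine (h.crownVertices_subset_biUnion.trans ?_).antisymm ?_
  · exact biUnion_mono fun x _ => sdiff_subset
  · exact subset_sdiff.2 ⟨subset_union_right, disjoint_biUnion_left _ _ _ |>.2 hd⟩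

lemma card_crownVertices_le_of_private_subset (h : IsCrown E S a W f e) (hx₀ : x₀ ∈ f \ W)
    (hy : privateVertices W f e x₀ ⊆ {y}) :
    #(crownVertices W f e) ≤ (#(f \ W) - 1) * a + 2 := by
  have hsub : crownVertices W f e ⊆ ((f \ W).erase x₀).biUnion e ∪ {x₀, y} := by
    intro t ht
    obtain ⟨x, hx, htx⟩ := mem_biUnion.1 (h.crownVertices_subset_biUnion ht)
    obtain ⟨hte, htW⟩ := mem_sdiff.1 htx
    obtain rfl | hxx := eq_or_ne x x₀
    · by_cases htp : t ∈ privateVertices W f e x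
      · simp [mem_singleton.1 (hy htp)]
      · have := h.eq_of_mem (t := t) hx
        unfold privateVertices at htp
        grind
    · exact mem_union_left _ (mem_biUnion.2 ⟨x, mem_erase.2 ⟨hxx, hx⟩, hte⟩)
  refine (card_le_card hsub).trans ((card_union_le _ _).trans (Nat.add_le_add ?_ card_le_two))
  rw [← card_erase_of_mem hx₀]
  exact card_biUnion_le.trans (sum_le_card_nsmul _ _ _ fun x hx =>
    (h.card_eq x (mem_of_mem_erase hx)).le)

lemma exists_ne_mem_of_private_eq_empty (h : IsCrown E S a W f e)
    (hpriv : ∀ x ∈ f \ W, privateVertices W f e x = ∅) (ht : t ∈ crownVertices W f e)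
    (htf : t ∉ f) : ∃ x ∈ f \ W, ∃ x' ∈ f \ W, x ≠ x' ∧ t ∈ e x ∧ t ∈ e x' := by
  obtain ⟨x, hx, htx⟩ := mem_biUnion.1 (h.crownVertices_subset_biUnion ht)
  have htp : t ∉ privateVertices W f e x := hpriv x hx ▸ notMem_empty t
  have : t ∈ ((f \ W).erase x).biUnion e := by unfold privateVertices at htp; grind
  obtain ⟨x', hx', htx'⟩ := mem_biUnion.1 this
  exact ⟨x, hx, x', mem_of_mem_erase hx', (ne_of_mem_erase hx').symm, (mem_sdiff.1 htx).1, htx'⟩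

-- Double counting: the vertices outside of `f` lie in at least two of the edges `e x`.
lemma two_mul_card_crownVertices_le (h : IsCrown E S a W f e)
    (hpriv : ∀ x ∈ f \ W, privateVertices W f e x = ∅) :
    2 * #(crownVertices W f e) ≤ #(f \ W) + ∑ x ∈ f \ W, #(e x \ W) := by
  set T := crownVertices W f e
  have hdeg : ∀ t ∈ T, 2 ≤ (if t ∈ f \ W then 1 else 0) + #{x ∈ f \ W | t ∈ e x} := by
    intro t ht
    by_cases htf : t ∈ f
    · have htU : t ∈ f \ W := mem_sdiff.2 ⟨htf, (mem_sdiff.1 ht).2⟩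
      have : 0 < #{x ∈ f \ W | t ∈ e x} := card_pos.2 ⟨t, mem_filter.2 ⟨htU, h.mem_edge htU⟩⟩
      rw [if_pos htU]
      omega
    · obtain ⟨x, hx, x', hx', hne, htx, htx'⟩ := h.exists_ne_mem_of_private_eq_empty hpriv ht htf
      have : 1 < #{x ∈ f \ W | t ∈ e x} :=
        one_lt_card.2 ⟨x, mem_filter.2 ⟨hx, htx⟩, x', mem_filter.2 ⟨hx', htx'⟩, hne⟩
      omega
  have hU : ∑ t ∈ T, (if t ∈ f \ W then 1 else 0) = #(f \ W) := by
    rw [sum_boole, filter_mem_eq_inter, inter_eq_right.2 (sdiff_subset_crownVertices W f e)]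
    rfl
  calc 2 * #T ≤ ∑ t ∈ T, ((if t ∈ f \ W then 1 else 0) + #{x ∈ f \ W | t ∈ e x}) := by
        rw [mul_comm]
        exact card_nsmul_le_sum _ _ _ hdeg
    _ = #(f \ W) + ∑ x ∈ f \ W, #{t ∈ T | t ∈ e x} := by
        rw [sum_add_distrib, hU]
        exact congrArg _ (sum_card_bipartiteAbove_eq_sum_card_bipartiteBelow fun t x => t ∈ e x)
    _ ≤ #(f \ W) + ∑ x ∈ f \ W, #(e x \ W) := by
        refine Nat.add_le_add_left (sum_le_sum fun x _ => card_le_card fun t ht => ?_) _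
        obtain ⟨htT, htx⟩ := mem_filter.1 ht
        exact mem_sdiff.2 ⟨htx, (mem_sdiff.1 htT).2⟩

lemma card_crownVertices_le_one (h : IsCrown E S a W f e)
    (hpriv : ∀ x ∈ f \ W, privateVertices W f e x = ∅) (hone : #(f \ W) ≤ 1) :
    #(crownVertices W f e) ≤ 1 := by
  refine (card_le_card fun t ht => ?_).trans hone
  refine mem_sdiff.2 ⟨not_not.1 fun htf => ?_, (mem_sdiff.1 ht).2⟩
  obtain ⟨x, hx, x', hx', hne, -⟩ := h.exists_ne_mem_of_private_eq_empty hpriv ht htf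
  exact hne (card_le_one.1 hone x hx x' hx')

lemma crownVertices_subset (h : IsCrown E S a W f e) : crownVertices W f e ⊆ S :=
  sdiff_subset.trans (union_subset h.base_subset (biUnion_subset.2 h.subset))

lemma card_crownVertices_le_mul (h : IsCrown E S a W f e) : #(crownVertices W f e) ≤ a * #f :=
  h.card_crownVertices_le.trans
    ((Nat.mul_le_mul_right a (card_le_card sdiff_subset)).trans (mul_comm _ _).le)

lemma isExtension {k : ℕ} (h : IsCrown E S a W f e)
    (hk : ChainRank E W (W ∪ crownVertices W f e) k) :
    IsExtension E S (a * #f) W (crownVertices W f e) k :=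
  ⟨h.crownVertices_subset, disjoint_sdiff, h.card_crownVertices_le_mul, hk⟩

end IsCrown

end Crowns

/-! ### Walks along crowns -/

section CrownWalks

variable {α : Type*} [DecidableEq α]

/-- Two uniform families of edges inside of `S` such that through every vertex of an edge of one of
them there is an edge of the other one which meets the first edge in this vertex only. -/
structure IsCrossing (E : Finset α → Prop) (S : Finset α) (a b : ℕ)
    (FA FB : Finset (Finset α)) : Prop where
  isEdge_left : ∀ e ∈ FA, E e
  isEdge_right : ∀ f ∈ FB, E f
  subset_left : ∀ e ∈ FA, e ⊆ S
  subset_right : ∀ f ∈ FB, f ⊆ S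
  card_left : ∀ e ∈ FA, #e = a
  card_right : ∀ f ∈ FB, #f = b
  cross_left : ∀ e ∈ FA, ∀ x ∈ e, ∃ f ∈ FB, e ∩ f = {x}
  cross_right : ∀ f ∈ FB, ∀ x ∈ f, ∃ e ∈ FA, e ∩ f = {x}

/-- The parameters of the exploration of a crossing pair of an `a`-uniform and a `b`-uniform family:
a local step glues a crown with `b - 1` disjoint edges to the current set at a single vertex. -/
structure IsCrownScheme (P : Scheme) (a b : ℕ) : Prop where
  one_le_left : 1 ≤ a
  two_le_right : 2 ≤ b
  stepSize_eq : P.stepSize = a * (b - 1)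
  stepEdges_eq : P.stepEdges = b
  maxSize_eq : P.maxSize = a * b
  mul_density : a * P.density = 1 + P.slack
  sub_one_mul_slack : ((b : ℝ) - 1) * P.slack = 1
  slack_pos : 0 < P.slack
  slack_le : P.slack ≤ 1 / 3
  density_le : P.density ≤ 4 / 9
  slack_le_density : P.slack ≤ P.density

/-- The vertex `y` of `W` lies in an edge of the family which is not contained in `W`. -/
def IsFrontier (FB : Finset (Finset α)) (W : Finset α) (y : α) : Prop :=
  y ∈ W ∧ ∃ f ∈ FB, y ∈ f ∧ ¬ f ⊆ W

/-- The exceptional outcomes of an attempt to enlarge `W`: a set that is dense by itself, an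
extension decreasing the exponent by more than the slack, and an extension decreasing it by at least
the slack after which the exploration can go on. -/
def IsExceptional (P : Scheme) (E : Finset α → Prop) (S : Finset α) (FB : Finset (Finset α))
    (W : Finset α) : Prop :=
  (∃ T k, IsExtension E S P.maxSize ∅ T k ∧ P.density * #T - k < 0) ∨
  (∃ T k, IsExtension E S P.maxSize W T k ∧ P.density * #T - k < -P.slack) ∨
  ∃ T k y, IsExtension E S P.maxSize W T k ∧ P.density * #T - k ≤ -P.slack ∧
    IsFrontier FB (W ∪ T) y

namespace IsCrownScheme

variable {P : Scheme} {a b u N : ℕ}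

lemma density_pos (hP : IsCrownScheme P a b) : 0 < P.density :=
  hP.slack_pos.trans_le hP.slack_le_density

lemma mul_slack_le_one (hP : IsCrownScheme P a b) (hu : u + 1 ≤ b) : u * P.slack ≤ 1 := by
  have hu' : (u : ℝ) + 1 ≤ b := by exact_mod_cast hu
  rw [← hP.sub_one_mul_slack]
  exact mul_le_mul_of_nonneg_right (by linarith) hP.slack_pos.le

lemma density_mul_le (hP : IsCrownScheme P a b) (hN : N ≤ u * a) :
    P.density * N ≤ u * (1 + P.slack) := by
  have hN' : (N : ℝ) ≤ u * a := by exact_mod_cast hN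
  calc P.density * N ≤ P.density * (u * a) := mul_le_mul_of_nonneg_left hN' hP.density_pos.le
    _ = u * (1 + P.slack) := by rw [← hP.mul_density]; ring

lemma two_mul_density_mul_le {j : ℕ} (hP : IsCrownScheme P a b)
    (hN : 2 * N + j ≤ u + u * a) :
    2 * (P.density * N) ≤ u * (P.density + 1 + P.slack) - P.density * j := by
  have hN' : 2 * (N : ℝ) + j ≤ u + u * a := by exact_mod_cast hN
  have := mul_le_mul_of_nonneg_left hN' hP.density_pos.le
  linear_combination this + u * hP.mul_density

lemma exponent_neg_of_shared (hP : IsCrownScheme P a b) (hu : 1 ≤ u)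
    (hN : 2 * N ≤ u + u * a) : P.density * N - u < 0 := by
  have hu' : (1 : ℝ) ≤ u := by exact_mod_cast hu
  have := hP.two_mul_density_mul_le (j := 0) hN
  push_cast at this
  nlinarith [hP.slack_le, hP.density_le]

lemma exponent_lt_of_shared (hP : IsCrownScheme P a b) (hu : 2 ≤ u)
    (hN : 2 * N + 1 ≤ u + u * a) : P.density * N - u < -P.slack := by
  have hu' : (2 : ℝ) ≤ u := by exact_mod_cast hu
  have := hP.two_mul_density_mul_le (j := 1) hN
  push_cast at this
  nlinarith [hP.slack_le, hP.density_le, hP.density_pos]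

lemma exponent_lt_of_one_private (hP : IsCrownScheme P a b) (hu : 1 ≤ u) (hub : u + 1 ≤ b)
    (hN : N ≤ (u - 1) * a + 2) : P.density * N - (u + 1 : ℕ) < -P.slack := by
  obtain ⟨v, rfl⟩ := Nat.exists_eq_add_of_le' hu
  have hN' : (N : ℝ) ≤ v * a + 2 := by exact_mod_cast hN
  have hle : P.density * N ≤ v * (1 + P.slack) + 2 * P.density := by
    linear_combination mul_le_mul_of_nonneg_left hN' hP.density_pos.le + v * hP.mul_density
  have := hP.mul_slack_le_one hub
  push_cast at this ⊢
  linarith [hP.density_le]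

lemma exponent_lt_of_extra_edge (hP : IsCrownScheme P a b) (hub : u + 1 ≤ b) (hN : N ≤ u * a) :
    P.density * N - (u + 2 : ℕ) < -P.slack := by
  have hle := hP.density_mul_le hN
  have := hP.mul_slack_le_one hub
  push_cast
  linarith [hP.slack_le]

lemma exponent_le_of_not_full (hP : IsCrownScheme P a b) (hub : u + 1 ≤ b) (hN : N ≤ u * a)
    (hfull : ¬ (u + 1 = b ∧ N = u * a)) : P.density * N - (u + 1 : ℕ) ≤ -P.slack := by
  push_cast
  rcases not_and_or.1 hfull with hu | hN'
  · have hle := hP.density_mul_le hN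
    have := hP.mul_slack_le_one (by omega : u + 1 + 1 ≤ b)
    push_cast at this
    linarith
  · have hlt : (N : ℝ) + 1 ≤ u * a := by exact_mod_cast (by omega : N + 1 ≤ u * a)
    have := mul_le_mul_of_nonneg_left hlt hP.density_pos.le
    linear_combination hP.mul_slack_le_one hub + this + u * hP.mul_density + hP.slack_le_density

end IsCrownScheme

namespace IsCrown

variable {P : Scheme} {E : Finset α → Prop} {S W f : Finset α} {FB : Finset (Finset α)} {a : ℕ}
  {e : α → Finset α} {x₀ y y' : α}

lemma isExceptional_of_private_eq_empty (h : IsCrown E S a W f e) (hP : IsCrownScheme P a #f)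
    (hfW : (f \ W).Nonempty) (hpriv : ∀ x ∈ f \ W, privateVertices W f e x = ∅) :
    IsExceptional P E S FB W := by
  have hU : 1 ≤ #(f \ W) := hfW.card_pos
  have hcard := h.two_mul_card_crownVertices_le hpriv
  by_cases hmeet : ∀ x ∈ f \ W, Disjoint (e x) W
  · have hchain := h.chainRank_biUnion subset_rfl (empty_subset W)
    rw [empty_union, ← h.crownVertices_eq_biUnion hmeet] at hchain
    have hT := IsExtension.of_empty h.crownVertices_subset h.card_crownVertices_le_mul hchain
    refine .inl ⟨_, _, hP.maxSize_eq ▸ hT, hP.exponent_neg_of_shared hU ?_⟩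
    exact hcard.trans (Nat.add_le_add_left h.sum_card_sdiff_le _)
  · push Not at hmeet
    obtain ⟨x, hx, hmeet⟩ := hmeet
    have hchain := (h.chainRank_biUnion subset_rfl (subset_refl W)).mono (Y := W ∪ _)
      ((union_subset_union_right subset_union_right).trans_eq (union_crownVertices W f e).symm)
    refine .inr (.inl ⟨_, _, hP.maxSize_eq ▸ h.isExtension hchain, ?_⟩)
    rcases hU.eq_or_lt with hone | htwo
    · have hle := h.card_crownVertices_le_one hpriv hone.ge
      have : P.density * #(crownVertices W f e) ≤ P.density * 1 :=
        mul_le_mul_of_nonneg_left (by exact_mod_cast hle) hP.density_pos.le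
      rw [← hone]
      push_cast
      linarith [hP.slack_le, hP.density_le]
    · exact hP.exponent_lt_of_shared htwo (by have := h.sum_card_sdiff_lt hx hmeet; omega)

lemma isLocalExtension (h : IsCrown E S a W f e) (hP : IsCrownScheme P a #f)
    (hyf : y ∈ f) (hyW : y ∈ W) (hx₀ : x₀ ∈ f \ W) (hy' : y' ∈ privateVertices W f e x₀)
    (hU : #(f \ W) + 1 = #f) (hcard : #(crownVertices W f e) = #(f \ W) * a) :
    IsLocalExtension P E S W y (crownVertices W f e) y' where
  subset := h.crownVertices_subset
  disjoint := disjoint_sdiff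
  mem := privateVertices_subset_crownVertices hx₀ hy'
  card_eq := by rw [hcard, hP.stepSize_eq, ← hU, Nat.add_sub_cancel, mul_comm]
  chainRank := by
    rw [hP.stepEdges_eq, ← hU]
    refine (h.chainRank_of_private (singleton_subset_iff.2 hyW) hx₀ hy').mono ?_
    have hinter : ∀ t ∈ f ∩ W, t = y := by
      have : #(f ∩ W) ≤ 1 := by have := card_sdiff_add_card_inter f W; omega
      exact fun t ht => card_le_one.1 this t ht y (mem_inter.2 ⟨hyf, hyW⟩)
    rw [h.crownVertices_eq_biUnion fun _ hx => h.disjoint_of_card_eq hcard hx]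
    refine union_subset subset_union_left (union_subset (fun t ht => ?_) subset_union_right)
    by_cases htW : t ∈ W
    · exact mem_union_left _ (mem_singleton.2 (hinter t (mem_inter.2 ⟨ht, htW⟩)))
    · have htU : t ∈ f \ W := mem_sdiff.2 ⟨ht, htW⟩
      exact mem_union_right _ (mem_biUnion.2 ⟨t, htU, h.mem_edge htU⟩)

lemma isExceptional_or_exists_isLocalExtension (h : IsCrown E S a W f e)
    (hP : IsCrownScheme P a #f) (hE : ∀ g ∈ FB, E g)
    (hcross : ∀ x ∈ f \ W, ∀ y ∈ e x, ∃ g ∈ FB, e x ∩ g = {y})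
    (hyf : y ∈ f) (hyW : y ∈ W) (hfW : (f \ W).Nonempty) :
    IsExceptional P E S FB W ∨
      ∃ T y', IsLocalExtension P E S W y T y' ∧ IsFrontier FB (W ∪ T) y' := by
  have hU : 1 ≤ #(f \ W) := hfW.card_pos
  have hUf : #(f \ W) + 1 ≤ #f := by
    have := card_sdiff_add_card_inter f W
    have := card_pos.2 ⟨y, mem_inter.2 ⟨hyf, hyW⟩⟩
    omega
  by_cases hpriv : ∀ x ∈ f \ W, privateVertices W f e x = ∅
  · exact .inl (h.isExceptional_of_private_eq_empty hP hfW hpriv)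
  push Not at hpriv
  obtain ⟨x₀, hx₀, y', hy'⟩ := hpriv
  have hT := h.isExtension (union_crownVertices W f e ▸ h.chainRank_of_private subset_rfl hx₀ hy')
  rw [← hP.maxSize_eq] at hT
  by_cases hone : privateVertices W f e x₀ ⊆ {y'}
  · exact .inl (.inr (.inl ⟨_, _, hT, hP.exponent_lt_of_one_private hU hUf
      (h.card_crownVertices_le_of_private_subset hx₀ hone)⟩))
  obtain ⟨z, hz, hzy⟩ := not_subset.1 hone
  obtain ⟨g, hg, hgy⟩ := hcross x₀ hx₀ y' (mem_sdiff.1 hy').1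
  by_cases hgsub : g ⊆ W ∪ crownVertices W f e
  · have hchain := h.chainRank_of_private_pair hx₀ hy' hz (notMem_singleton.1 hzy) (hE g hg) hgy
      hgsub
    exact .inl (.inr (.inl ⟨_, _, hP.maxSize_eq ▸ h.isExtension hchain,
      hP.exponent_lt_of_extra_edge hUf h.card_crownVertices_le⟩))
  have hfront : IsFrontier FB (W ∪ crownVertices W f e) y' :=
    ⟨mem_union_right _ (privateVertices_subset_crownVertices hx₀ hy'), g, hg,
      (mem_inter.1 (hgy.symm ▸ mem_singleton_self y')).2, hgsub⟩
  by_cases hfull : #(f \ W) + 1 = #f ∧ #(crownVertices W f e) = #(f \ W) * a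
  · exact .inr ⟨_, y', h.isLocalExtension hP hyf hyW hx₀ hy' hfull.1 hfull.2, hfront⟩
  · exact .inl (.inr (.inr ⟨_, _, y', hT,
      hP.exponent_le_of_not_full hUf h.card_crownVertices_le hfull, hfront⟩))

end IsCrown

namespace IsCrossing

variable {P : Scheme} {E : Finset α → Prop} {V S W e : Finset α} {FA FB : Finset (Finset α)}
  {a b L i : ℕ} {y : α}

lemma exists_isCrown (h : IsCrossing E S a b FA FB) (W : Finset α) {f : Finset α} (hf : f ∈ FB) :
    ∃ e : α → Finset α, (∀ x ∈ f, e x ∈ FA) ∧ IsCrown E S a W f e := by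
  choose! e he hinter using h.cross_right f hf
  have hsub : f \ W ⊆ f := sdiff_subset
  exact ⟨e, he, h.isEdge_right f hf, h.subset_right f hf,
    fun x hx => h.isEdge_left _ (he x (hsub hx)), fun x hx => h.subset_left _ (he x (hsub hx)),
    fun x hx => h.card_left _ (he x (hsub hx)), fun x hx => hinter x (hsub hx)⟩

lemma isExceptional_or_exists_isLocalExtension (h : IsCrossing E S a b FA FB)
    (hP : IsCrownScheme P a b) (hy : IsFrontier FB W y) :
    IsExceptional P E S FB W ∨
      ∃ T y', IsLocalExtension P E S W y T y' ∧ IsFrontier FB (W ∪ T) y' := by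
  obtain ⟨hyW, f, hf, hyf, hfW⟩ := hy
  obtain ⟨e, heA, he⟩ := h.exists_isCrown W hf
  exact he.isExceptional_or_exists_isLocalExtension (by rwa [h.card_right f hf]) h.isEdge_right
    (fun x hx => h.cross_left _ (heA x (mem_sdiff.1 hx).1)) hyf hyW (sdiff_nonempty.2 hfW)

lemma exists_isFrontier (h : IsCrossing E S a b FA FB) (ha : 1 ≤ a) (hb : 2 ≤ b) (he : e ∈ FA) :
    ∃ y, IsFrontier FB e y := by
  obtain ⟨y, hy⟩ : e.Nonempty := card_pos.1 (by rw [h.card_left e he]; omega)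
  obtain ⟨f, hf, hef⟩ := h.cross_left e he y hy
  refine ⟨y, hy, f, hf, (mem_inter.1 (hef.symm ▸ mem_singleton_self y)).2, fun hfe => ?_⟩
  have hcard := h.card_right f hf
  rw [← inter_eq_right.2 hfe, hef, card_singleton] at hcard
  omega

variable [Inhabited α]

lemma isExplored_single (h : IsCrossing E S a b FA FB) (hP : IsCrownScheme P a b)
    (hSV : S ⊆ V) (he : e ∈ FA) (hy : y ∈ e) : IsExplored P E V L S [⟨a, 1, 0⟩] (e, y) := by
  have hT : IsExtension E S P.maxSize ∅ e 1 := by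
    refine .of_empty (h.subset_left e he) ?_ (.single (h.isEdge_left e he) ⟨y, hy⟩)
    rw [hP.maxSize_eq, h.card_left e he]
    exact Nat.le_mul_of_pos_right _ (by have := hP.two_le_right; omega)
  simpa only [empty_union, h.card_left e he] using
    (IsExplored.nil (empty_subset S)).attach hSV hT (y := y) (by simp [hy])

lemma exists_walk_until_exceptional {l : List Stage} {s : Finset α × α} {N k : ℕ}
    (h : IsCrossing E S a b FA FB) (hP : IsCrownScheme P a b) (hSV : S ⊆ V)
    (hs : IsExplored P E V L S (⟨N, k, 0⟩ :: l) s) (hy : IsFrontier FB s.1 s.2) :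
    ∃ i s', IsExplored P E V L S (⟨N, k, i⟩ :: l) s' ∧ (i = L ∨ IsExceptional P E S FB s'.1) :=
  IsExplored.exists_walk (Inv := IsFrontier FB) (Halt := fun W _ => IsExceptional P E S FB W) hSV
    (fun _ _ => h.isExceptional_or_exists_isLocalExtension hP) hs hy

lemma hasRareExploration_of_second_stage {s : Finset α × α} {N k : ℕ}
    (h : IsCrossing E S a b FA FB) (hP : IsCrownScheme P a b) (hSV : S ⊆ V)
    (hs : IsExplored P E V L S [⟨N, k, 0⟩, ⟨a, 1, i⟩] s) (hy : IsFrontier FB s.1 s.2)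
    (hle : P.density * N - k ≤ -P.slack) : HasRareExploration P E V L S := by
  have hslack := hP.slack_pos
  have hmul := hP.mul_density
  obtain ⟨j, s', hs', rfl | hdense | hex⟩ := h.exists_walk_until_exceptional hP hSV hs hy
  · refine ⟨_, s', by simp, hs', .inr ⟨?_, by simp [stageLength]⟩⟩
    simp only [stageExponent_cons, stageExponent_nil]
    push_cast
    linarith
  · obtain ⟨T, k, hT, hneg⟩ := hdense
    exact hasRareExploration_of_dense hSV hT hneg
  · obtain ⟨T, k', hT, hle'⟩ :
        ∃ T k, IsExtension E S P.maxSize s'.1 T k ∧ P.density * #T - k ≤ -P.slack := by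
      rcases hex with ⟨T, k', hT, hlt⟩ | ⟨T, k', -, hT, hle', -⟩
      · exact ⟨T, k', hT, hlt.le⟩
      · exact ⟨T, k', hT, hle'⟩
    refine ⟨_, _, by simp, hs'.attach hSV hT (mem_insert_self _ _), .inl ?_⟩
    simp only [stageExponent_cons, stageExponent_nil]
    push_cast
    linarith

-- The first edge has exponent `slack`. Each of the (at most two) exceptional extensions costs at
-- least `slack`, so that the second one makes the exponent negative.
theorem hasRareExploration (h : IsCrossing E S a b FA FB) (hP : IsCrownScheme P a b)
    (hne : FA.Nonempty) (hSV : S ⊆ V) : HasRareExploration P E V L S := by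
  have hmul := hP.mul_density
  obtain ⟨e, he⟩ := hne
  obtain ⟨y, hy⟩ := h.exists_isFrontier hP.one_le_left hP.two_le_right he
  obtain ⟨i, s, hs, rfl | hdense | ⟨T, k, hT, hlt⟩ | ⟨T, k, y', hT, hle, hy'⟩⟩ :=
    h.exists_walk_until_exceptional hP hSV (h.isExplored_single hP hSV he hy.1) hy
  · refine ⟨_, s, by simp, hs, .inr ⟨?_, by simp [stageLength]⟩⟩
    simp only [stageExponent_cons, stageExponent_nil]
    push_cast
    linarith
  · obtain ⟨T, k, hT, hneg⟩ := hdense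
    exact hasRareExploration_of_dense hSV hT hneg
  · refine ⟨_, _, by simp, hs.attach hSV hT (mem_insert_self _ _), .inl ?_⟩
    simp only [stageExponent_cons, stageExponent_nil]
    push_cast
    linarith
  · exact h.hasRareExploration_of_second_stage hP hSV
      (hs.attach hSV hT (mem_insert_of_mem hy'.1)) hy' hle

end IsCrossing

end CrownWalks

/-! ### Systems of triples -/

section Triples

variable {α : Type*} [DecidableEq α]

/-- A system of triples inside of `S`, as it arises from a minimal uncolourable pair of `3`-uniform
families: every two-colouring has a monochromatic triple, every vertex of a triple is its
intersection with another triple, and a union of components contains all the triples. -/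
structure IsTripleSystem (E : Finset α → Prop) (S : Finset α) (G : Finset (Finset α)) : Prop where
  isEdge : ∀ g ∈ G, E g
  subset : ∀ g ∈ G, g ⊆ S
  card_eq : ∀ g ∈ G, #g = 3
  cross : ∀ g ∈ G, ∀ x ∈ g, ∃ h ∈ G, g ∩ h = {x}
  subset_of_closed : ∀ Z, (∀ g ∈ G, g ⊆ Z ∨ Disjoint g Z) → (∃ g ∈ G, g ⊆ Z) → ∀ g ∈ G, g ⊆ Z
  uncolourable : ∀ C, ∃ g ∈ G, g ⊆ C ∨ Disjoint g C

/-- The parameters of the exploration of a system of triples: a local step adds a triple which meets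
the current set in a single vertex. -/
noncomputable def tripleScheme : Scheme where
  stepSize := 2
  stepEdges := 1
  maxSize := 6
  density := 1 / 2
  slack := 1 / 2

lemma sdiff_insert_mem_of_linear {G : Finset (Finset α)} {Z D e : Finset α} {p : α}
    (hGZ : ∀ g ∈ G, g ⊆ Z) (hcard : ∀ g ∈ G, #g = 3) (hZ : #Z = 6)
    (hlin : ∀ g ∈ G, ∀ h ∈ G, g ≠ h → #(g ∩ h) ≤ 1)
    (hcol : ∀ C, ∃ g ∈ G, g ⊆ C ∨ Disjoint g C)
    (he : e ∈ G) (hDe : D ⊆ e) (hD : #D = 2) (hp : p ∈ Z \ e) : Z \ insert p D ∈ G := by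
  obtain ⟨hpZ, hpe⟩ := mem_sdiff.1 hp
  have hC : #(insert p D) = 3 := by rw [card_insert_of_notMem fun h => hpe (hDe h), hD]
  have hCZ : insert p D ⊆ Z := insert_subset hpZ (hDe.trans (hGZ e he))
  obtain ⟨g, hg, hgC | hgC⟩ := hcol (insert p D)
  · have hgeq : g = insert p D := eq_of_subset_of_card_le hgC (by rw [hC, hcard g hg])
    have hDge : D ⊆ g ∩ e := subset_inter (hgeq ▸ subset_insert p D) hDe
    have hge : #(g ∩ e) ≤ 1 := hlin g hg e he fun h => hpe (h ▸ hgeq ▸ mem_insert_self p D)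
    have := card_le_card hDge
    omega
  · rwa [← eq_of_subset_of_card_le (subset_sdiff.2 ⟨hGZ g hg, hgC⟩)
      (by rw [card_sdiff_of_subset hCZ, hZ, hC, hcard g hg])]

lemma exists_colouring_of_linear {G : Finset (Finset α)} {Z : Finset α} (hGZ : ∀ g ∈ G, g ⊆ Z)
    (hcard : ∀ g ∈ G, #g = 3) (hZ : #Z = 6) (hlin : ∀ g ∈ G, ∀ h ∈ G, g ≠ h → #(g ∩ h) ≤ 1) :
    ∃ C : Finset α, ∀ g ∈ G, ¬ g ⊆ C ∧ ¬ Disjoint g C := by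
  by_contra! hcon
  have hcol : ∀ C, ∃ g ∈ G, g ⊆ C ∨ Disjoint g C := fun C =>
    (hcon C).imp fun g hg => ⟨hg.1, or_iff_not_imp_left.2 hg.2⟩
  obtain ⟨e, he, -⟩ := hcol ∅
  obtain ⟨D, hDe, hD⟩ := exists_subset_card_eq (s := e) (n := 2) (by rw [hcard e he]; omega)
  have hZe : #(Z \ e) = 3 := by rw [card_sdiff_of_subset (hGZ e he), hZ, hcard e he]
  obtain ⟨p, hp, q, hq, hpq⟩ := one_lt_card.1 (by omega : 1 < #(Z \ e))
  have hmem : ∀ r ∈ Z \ e, Z \ insert r D ∈ G := fun r =>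
    sdiff_insert_mem_of_linear hGZ hcard hZ hlin hcol he hDe hD
  have hqD : q ∉ D := fun h => (mem_sdiff.1 hq).2 (hDe h)
  have hne : Z \ insert p D ≠ Z \ insert q D := fun h => by
    have : q ∈ Z \ insert q D := h ▸ mem_sdiff.2 ⟨(mem_sdiff.1 hq).1, by simp [hpq.symm, hqD]⟩
    simp at this
  have hle := hlin _ (hmem p hp) _ (hmem q hq) hne
  rw [← sdiff_union_distrib] at hle
  have hunion : insert p D ∪ insert q D = insert p (insert q D) := by grind
  have hZcard := le_card_sdiff (insert p D ∪ insert q D) Z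
  have := card_insert_le p (insert q D)
  have := card_insert_le q D
  rw [hunion] at hle hZcard
  omega

namespace IsTripleSystem

variable {E : Finset α → Prop} {V S W Z e f g h : Finset α} {G : Finset (Finset α)} {k L : ℕ}
  {t u y z : α}

lemma nonempty (hG : IsTripleSystem E S G) (hg : g ∈ G) : g.Nonempty :=
  card_pos.1 (by rw [hG.card_eq g hg]; omega)

lemma not_subset_of_inter_eq_singleton (hG : IsTripleSystem E S G) (hh : h ∈ G)
    (hgh : g ∩ h = {t}) : ¬ h ⊆ g := fun hsub => by
  have hcard := hG.card_eq h hh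
  rw [← inter_eq_right.2 hsub, hgh, card_singleton] at hcard
  omega

lemma isExtension_one (hG : IsTripleSystem E S G) (hg : g ∈ G) (hgW : ¬ g ⊆ W) :
    IsExtension E S tripleScheme.maxSize W (g \ W) 1 where
  subset := sdiff_subset.trans (hG.subset g hg)
  disjoint := disjoint_sdiff
  card_le := (card_le_card sdiff_subset).trans ((hG.card_eq g hg).le.trans (by decide : 3 ≤ 6))
  chainRank := by
    rw [union_sdiff_self_eq_union]
    exact (ChainRank.zero subset_rfl).add_edge (hG.isEdge g hg) hgW

-- The triple `h` comes first, and `g` still has its other vertex outside of `W` to itself.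
lemma isExtension_two (hG : IsTripleSystem E S G) (hg : g ∈ G) (hh : h ∈ G)
    (hcard : #(g \ W) = 2) (ht : t ∈ g \ W) (hgh : g ∩ h = {t}) (hsub : h ⊆ W ∪ g) :
    IsExtension E S tripleScheme.maxSize W (g \ W) 2 where
  subset := sdiff_subset.trans (hG.subset g hg)
  disjoint := disjoint_sdiff
  card_le := hcard.le.trans (by decide : 2 ≤ 6)
  chainRank := by
    have hth : t ∈ h := (mem_inter.1 (hgh.symm ▸ mem_singleton_self t)).2
    obtain ⟨u, hu, hut⟩ := exists_mem_ne (by omega : 1 < #(g \ W)) t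
    rw [union_sdiff_self_eq_union]
    have hchain := ((ChainRank.zero subset_rfl).add_edge (hG.isEdge h hh) fun hhW =>
      (mem_sdiff.1 ht).2 (hhW hth)).add_edge (hG.isEdge g hg) fun hgWh => ?_
    · exact hchain.mono (union_subset (union_subset subset_union_left hsub) subset_union_right)
    · rcases mem_union.1 (hgWh (mem_sdiff.1 hu).1) with huW | huh
      · exact (mem_sdiff.1 hu).2 huW
      · exact hut (mem_singleton.1 (hgh ▸ mem_inter.2 ⟨(mem_sdiff.1 hu).1, huh⟩))

lemma isLocalExtension (hG : IsTripleSystem E S G) (hg : g ∈ G) (hyg : y ∈ g) (hyW : y ∈ W)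
    (hcard : #(g \ W) = 2) (ht : t ∈ g \ W) :
    IsLocalExtension tripleScheme E S W y (g \ W) t where
  subset := sdiff_subset.trans (hG.subset g hg)
  disjoint := disjoint_sdiff
  mem := ht
  card_eq := hcard
  chainRank := by
    have hinter : #(g ∩ W) ≤ 1 := by
      have := card_sdiff_add_card_inter g W
      have := hG.card_eq g hg
      omega
    refine .succ (.zero subset_rfl) subset_union_left (hG.isEdge g hg) (fun z hz => ?_)
      fun hgy => ?_
    · by_cases hzW : z ∈ W
      · have := card_le_one.1 hinter z (mem_inter.2 ⟨hz, hzW⟩) y (mem_inter.2 ⟨hyg, hyW⟩)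
        exact mem_union_left _ (mem_singleton.2 this)
      · exact mem_union_right _ (mem_sdiff.2 ⟨hz, hzW⟩)
    · exact (mem_sdiff.1 ht).2 (mem_singleton.1 (hgy (mem_sdiff.1 ht).1) ▸ hyW)

lemma card_sdiff_eq_two (hG : IsTripleSystem E S G) (hg : g ∈ G) (hyg : y ∈ g) (hyW : y ∈ W)
    (hcard : ¬ #(g \ W) ≤ 1) : #(g \ W) = 2 := by
  have := card_sdiff_add_card_inter g W
  have := hG.card_eq g hg
  have := card_pos.2 ⟨y, mem_inter.2 ⟨hyg, hyW⟩⟩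
  omega

lemma isExtension_or_exists_cross (hG : IsTripleSystem E S G) (hg : g ∈ G) (hcard : #(g \ W) = 2)
    (ht : t ∈ g \ W) : IsExtension E S tripleScheme.maxSize W (g \ W) 2 ∨
      ∃ h ∈ G, g ∩ h = {t} ∧ ¬ h ⊆ W ∪ g \ W := by
  obtain ⟨h, hh, hgh⟩ := hG.cross g hg t (mem_sdiff.1 ht).1
  by_cases hsub : h ⊆ W ∪ g
  · exact .inl (hG.isExtension_two hg hh hcard ht hgh hsub)
  · exact .inr ⟨h, hh, hgh, by rwa [union_sdiff_self_eq_union]⟩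

lemma exists_isLocalExtension_of_isFrontier (hG : IsTripleSystem E S G) (hy : IsFrontier G W y) :
    (∃ T k, IsExtension E S tripleScheme.maxSize W T k ∧ tripleScheme.density * #T - k < 0) ∨
      ∃ T y', IsLocalExtension tripleScheme E S W y T y' ∧ IsFrontier G (W ∪ T) y' := by
  obtain ⟨hyW, g, hg, hyg, hgW⟩ := hy
  by_cases hone : #(g \ W) ≤ 1
  · refine .inl ⟨_, _, hG.isExtension_one hg hgW, ?_⟩
    have : (#(g \ W) : ℝ) ≤ 1 := by exact_mod_cast hone
    norm_num [tripleScheme]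
    linarith
  have htwo := hG.card_sdiff_eq_two hg hyg hyW hone
  obtain ⟨t, ht⟩ : (g \ W).Nonempty := card_pos.1 (by omega)
  rcases hG.isExtension_or_exists_cross hg htwo ht with hext | ⟨h, hh, hgh, hhW⟩
  · exact .inl ⟨_, _, hext, by norm_num [tripleScheme, htwo]⟩
  · exact .inr ⟨_, t, hG.isLocalExtension hg hyg hyW htwo ht, mem_union_right _ ht, h, hh,
      (mem_inter.1 (hgh.symm ▸ mem_singleton_self t)).2, hhW⟩

lemma four_lt_card_of_forall_subset (hG : IsTripleSystem E S G) (hZ : ∀ g ∈ G, g ⊆ Z) : 4 < #Z := by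
  by_contra! hle
  obtain ⟨C, hCZ, hC⟩ := exists_subset_card_eq (s := Z) (n := #Z / 2) (Nat.div_le_self _ _)
  obtain ⟨g, hg, hgC | hgC⟩ := hG.uncolourable C
  · have := card_le_card hgC
    have := hG.card_eq g hg
    omega
  · have := card_le_card (subset_sdiff.2 ⟨hZ g hg, hgC⟩)
    rw [card_sdiff_of_subset hCZ, hC, hG.card_eq g hg] at this
    omega

variable [Inhabited α]

lemma hasRareExploration_of_isFrontier {l : List Stage} {s : Finset α × α} {N k : ℕ}
    (hG : IsTripleSystem E S G) (hSV : S ⊆ V)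
    (hs : IsExplored tripleScheme E V L S (⟨N, k, 0⟩ :: l) s) (hl : l.length ≤ 1)
    (hy : IsFrontier G s.1 s.2) (hle : stageExponent tripleScheme (⟨N, k, 0⟩ :: l) ≤ 0) :
    HasRareExploration tripleScheme E V L S := by
  simp only [stageExponent_cons] at hle
  obtain ⟨i, s', hs', rfl | ⟨T, k', hT, hneg⟩⟩ := IsExplored.exists_walk (Inv := IsFrontier G)
    (Halt := fun W _ => ∃ T k, IsExtension E S tripleScheme.maxSize W T k ∧
      tripleScheme.density * #T - k < 0)
    hSV (fun _ _ => hG.exists_isLocalExtension_of_isFrontier) hs hy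
  · refine ⟨_, s', ?_, hs', .inr ⟨?_, by simp [stageLength]⟩⟩
    · simp only [List.length_cons]
      omega
    · simp only [stageExponent_cons]
      exact hle.trans (by norm_num [tripleScheme])
  · refine ⟨_, _, ?_, hs'.attach hSV hT (mem_insert_self _ _), .inl ?_⟩
    · simp only [List.length_cons]
      omega
    · simp only [stageExponent_cons]
      linarith

lemma card_eq_and_subset_of_not_rare (hG : IsTripleSystem E S G) (hSV : S ⊆ V)
    (hrare : ¬ HasRareExploration tripleScheme E V L S) (hZS : Z ⊆ S) (hZ : #Z ≤ 6)
    (hk : ChainRank E ∅ Z k) (hZk : #Z ≤ 2 * k) (hin : ∃ g ∈ G, g ⊆ Z) :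
    #Z = 2 * k ∧ ∀ g ∈ G, g ⊆ Z := by
  have hT : IsExtension E S tripleScheme.maxSize ∅ Z k := .of_empty hZS hZ hk
  refine ⟨hZk.eq_of_not_lt fun hlt => hrare (hasRareExploration_of_dense hSV hT ?_),
    hG.subset_of_closed Z (fun g hg => or_iff_not_imp_left.2 fun hgZ => ?_) hin⟩
  · have : (#Z : ℝ) < 2 * k := by exact_mod_cast hlt
    norm_num [tripleScheme]
    linarith
  · by_contra hmeet
    obtain ⟨y, hyg, hyZ⟩ := not_disjoint_iff.1 hmeet
    refine hrare (hG.hasRareExploration_of_isFrontier hSV ((IsExplored.nil (empty_subset S)).attach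
      hSV hT (y := y) (by simp [hyZ])) (by simp) ?_ ?_)
    · simpa only [empty_union] using ⟨hyZ, g, hg, hyg, hgZ⟩
    · have : (#Z : ℝ) ≤ 2 * k := by exact_mod_cast hZk
      simp only [stageExponent_cons, stageExponent_nil]
      norm_num [tripleScheme]
      linarith

lemma card_inter_le_one_of_not_rare (hG : IsTripleSystem E S G) (hSV : S ⊆ V)
    (hrare : ¬ HasRareExploration tripleScheme E V L S) (hg : g ∈ G) (hh : h ∈ G) (hne : g ≠ h) :
    #(g ∩ h) ≤ 1 := by
  by_contra! htwo
  have hgcard := hG.card_eq g hg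
  have hhcard := hG.card_eq h hh
  have hunion := card_union_add_card_inter g h
  have hsub : ¬ h ⊆ g := fun hs => hne (eq_of_subset_of_card_le hs (by omega)).symm
  have hchain := (ChainRank.single (hG.isEdge g hg) (hG.nonempty hg)).add_edge (hG.isEdge h hh) hsub
  have hall := (hG.card_eq_and_subset_of_not_rare hSV hrare
    (union_subset (hG.subset g hg) (hG.subset h hh)) (by omega) hchain (by omega)
    ⟨g, hg, subset_union_left⟩).2
  have := hG.four_lt_card_of_forall_subset hall
  omega

lemma hasRareExploration_of_triangle (hG : IsTripleSystem E S G) (hSV : S ⊆ V)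
    {e f₁ f₂ : Finset α} {y₁ y₂ : α} (he : e ∈ G) (hf₁ : f₁ ∈ G) (hf₂ : f₂ ∈ G) (hy : y₁ ≠ y₂)
    (h₁ : e ∩ f₁ = {y₁}) (h₂ : e ∩ f₂ = {y₂}) (hz : (f₁ ∩ f₂).Nonempty) :
    HasRareExploration tripleScheme E V L S := by
  by_contra hrare
  have hinter : e ∩ (f₁ ∪ f₂) = {y₁, y₂} := by rw [inter_union_distrib_left, h₁, h₂]; rfl
  have hinter_card : #((f₁ ∪ f₂) ∩ e) = 2 := by rw [inter_comm, hinter, card_pair hy]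
  have hf₂sub : ¬ f₂ ⊆ f₁ := fun hsub => by
    have : e ∩ f₂ ⊆ e ∩ f₁ := inter_subset_inter_left hsub
    rw [h₁, h₂] at this
    exact hy (singleton_subset_singleton.1 this).symm
  have hesub : ¬ e ⊆ f₁ ∪ f₂ := fun hsub => by
    rw [inter_eq_right.2 hsub, hG.card_eq e he] at hinter_card
    omega
  have hchain : ChainRank E ∅ (f₁ ∪ f₂ ∪ e) 3 :=
    ((ChainRank.single (hG.isEdge f₁ hf₁) (hG.nonempty hf₁)).add_edge (hG.isEdge f₂ hf₂)
      hf₂sub).add_edge (hG.isEdge e he) hesub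
  have hcard : #(f₁ ∪ f₂ ∪ e) ≤ 6 := by
    have := card_union_add_card_inter (f₁ ∪ f₂) e
    have := card_union_add_card_inter f₁ f₂
    have := hz.card_pos
    have := hG.card_eq e he
    have := hG.card_eq f₁ hf₁
    have := hG.card_eq f₂ hf₂
    omega
  obtain ⟨hsix, hall⟩ := hG.card_eq_and_subset_of_not_rare hSV hrare
    (union_subset (union_subset (hG.subset f₁ hf₁) (hG.subset f₂ hf₂)) (hG.subset e he)) hcard
    hchain hcard ⟨e, he, subset_union_right⟩
  obtain ⟨C, hC⟩ := exists_colouring_of_linear hall hG.card_eq hsix fun g hg h hh =>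
    hG.card_inter_le_one_of_not_rare hSV hrare hg hh
  obtain ⟨g, hg, hgC⟩ := hG.uncolourable C
  exact hgC.elim (hC g hg).1 (hC g hg).2

end IsTripleSystem

/-- Two triples `f₁` and `f₂` leave `W`, from two different vertices of a triple `e ⊆ W`. -/
structure IsFork (G : Finset (Finset α)) (W e f₁ f₂ : Finset α) (y₁ y₂ : α) : Prop where
  base_mem : e ∈ G
  left_mem : f₁ ∈ G
  right_mem : f₂ ∈ G
  ne : y₁ ≠ y₂
  base_subset : e ⊆ W
  inter_left : e ∩ f₁ = {y₁}
  inter_right : e ∩ f₂ = {y₂}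
  left_not_subset : ¬ f₁ ⊆ W
  right_not_subset : ¬ f₂ ⊆ W

namespace IsFork

variable {G : Finset (Finset α)} {W e f₁ f₂ : Finset α} {y₁ y₂ : α}

lemma mem_base_inter_left (hF : IsFork G W e f₁ f₂ y₁ y₂) : y₁ ∈ e ∩ f₁ :=
  hF.inter_left.symm ▸ mem_singleton_self y₁

lemma mem_base_inter_right (hF : IsFork G W e f₁ f₂ y₁ y₂) : y₂ ∈ e ∩ f₂ :=
  hF.inter_right.symm ▸ mem_singleton_self y₂

end IsFork

namespace IsTripleSystem

variable {E : Finset α → Prop} {V S W e f₁ f₂ : Finset α} {G : Finset (Finset α)} {L : ℕ}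
  {y y₁ y₂ : α}

lemma exists_isFork (hG : IsTripleSystem E S G) (he : e ∈ G) :
    ∃ f₁ f₂ y₁ y₂, IsFork G e e f₁ f₂ y₁ y₂ := by
  obtain ⟨y₁, hy₁, y₂, hy₂, hne⟩ := one_lt_card.1 (by rw [hG.card_eq e he]; omega : 1 < #e)
  obtain ⟨f₁, hf₁, h₁⟩ := hG.cross e he y₁ hy₁
  obtain ⟨f₂, hf₂, h₂⟩ := hG.cross e he y₂ hy₂
  exact ⟨f₁, f₂, y₁, y₂, he, hf₁, hf₂, hne, subset_rfl, h₁, h₂,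
    hG.not_subset_of_inter_eq_singleton hf₁ h₁, hG.not_subset_of_inter_eq_singleton hf₂ h₂⟩

/-- The walk along the forks stops at `W` when an extension by two vertices has a chain of two
triples, or when one of the triples of the current fork has a single vertex outside of `W`. -/
def ForkHalts (E : Finset α → Prop) (S : Finset α) (G : Finset (Finset α)) (W : Finset α) : Prop :=
  (∃ T, IsExtension E S tripleScheme.maxSize W T 2 ∧ #T = 2) ∨
    ∃ e f₁ f₂ y₁ y₂, IsFork G W e f₁ f₂ y₁ y₂ ∧ #(f₁ \ W) ≤ 1

lemma forkHalts_or_exists_isLocalExtension (hG : IsTripleSystem E S G)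
    (hF : IsFork G W e f₁ f₂ y₁ y₂) :
    ForkHalts E S G W ∨ ∃ T y', IsLocalExtension tripleScheme E S W y₁ T y' ∧
      ∃ e f₁ f₂ y₂, IsFork G (W ∪ T) e f₁ f₂ y' y₂ := by
  obtain ⟨hye, hyf⟩ := mem_inter.1 hF.mem_base_inter_left
  by_cases hone : #(f₁ \ W) ≤ 1
  · exact .inl (.inr ⟨e, f₁, f₂, y₁, y₂, hF, hone⟩)
  have htwo := hG.card_sdiff_eq_two hF.left_mem hyf (hF.base_subset hye) hone
  obtain ⟨t, ht, u, hu, htu⟩ := one_lt_card.1 (by omega : 1 < #(f₁ \ W))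
  rcases hG.isExtension_or_exists_cross hF.left_mem htwo ht with hext | ⟨h, hh, hfh, hhW⟩
  · exact .inl (.inl ⟨_, hext, htwo⟩)
  rcases hG.isExtension_or_exists_cross hF.left_mem htwo hu with hext | ⟨h', hh', hfh', hhW'⟩
  · exact .inl (.inl ⟨_, hext, htwo⟩)
  refine .inr ⟨_, t, hG.isLocalExtension hF.left_mem hyf (hF.base_subset hye) htwo ht, f₁, h, h', u,
    hF.left_mem, hh, hh', htu, ?_, hfh, hfh', hhW, hhW'⟩
  rw [union_sdiff_self_eq_union]
  exact subset_union_right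

variable [Inhabited α]

-- Completing `f₁` makes the exponent nonpositive. If no other triple leaves `W ∪ f₁`, then `f₂` is
-- contained in it, and `e`, `f₁`, `f₂` form a triangle.
lemma hasRareExploration_of_isFork {s : Finset α × α} {i : ℕ} (hG : IsTripleSystem E S G)
    (hSV : S ⊆ V) (hs : IsExplored tripleScheme E V L S [⟨3, 1, i⟩] s)
    (hF : IsFork G s.1 e f₁ f₂ y₁ y₂) (hone : #(f₁ \ s.1) ≤ 1) :
    HasRareExploration tripleScheme E V L S := by
  by_cases hopen : ∃ y, IsFrontier G (s.1 ∪ f₁ \ s.1) y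
  · obtain ⟨y, hy⟩ := hopen
    refine hG.hasRareExploration_of_isFrontier hSV (hs.attach hSV
      (hG.isExtension_one hF.left_mem hF.left_not_subset) (mem_insert_of_mem hy.1)) (by simp) hy ?_
    have : (#(f₁ \ s.1) : ℝ) ≤ 1 := by exact_mod_cast hone
    simp only [stageExponent_cons, stageExponent_nil]
    norm_num [tripleScheme]
    linarith
  · simp only [IsFrontier, not_exists, not_and, not_not] at hopen
    obtain ⟨hye, hyf⟩ := mem_inter.1 hF.mem_base_inter_right
    have hf₂ := hopen y₂ (mem_union_left _ (hF.base_subset hye)) f₂ hF.right_mem hyf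
    obtain ⟨z, hzf₂, hzW⟩ := not_subset.1 hF.right_not_subset
    have hzf₁ : z ∈ f₁ :=
      (mem_sdiff.1 ((mem_union.1 (hf₂ hzf₂)).resolve_left hzW)).1
    exact hG.hasRareExploration_of_triangle hSV hF.base_mem hF.left_mem hF.right_mem hF.ne
      hF.inter_left hF.inter_right ⟨z, mem_inter.2 ⟨hzf₁, hzf₂⟩⟩

theorem hasRareExploration (hG : IsTripleSystem E S G) (hSV : S ⊆ V) :
    HasRareExploration tripleScheme E V L S := by
  obtain ⟨e, he, -⟩ := hG.uncolourable ∅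
  obtain ⟨f₁, f₂, y₁, y₂, hF⟩ := hG.exists_isFork he
  have hstart : IsExplored tripleScheme E V L S [⟨3, 1, 0⟩] (e, y₁) := by
    have hT : IsExtension E S tripleScheme.maxSize ∅ e 1 :=
      .of_empty (hG.subset e he) ((hG.card_eq e he).le.trans (by decide : 3 ≤ 6))
        (.single (hG.isEdge e he) (hG.nonempty he))
    simpa only [empty_union, hG.card_eq e he] using (IsExplored.nil (empty_subset S)).attach hSV hT
      (y := y₁) (by simp [(mem_inter.1 hF.mem_base_inter_left).1])
  obtain ⟨i, s, hs, rfl | ⟨T, hT, hcard⟩ | ⟨e, f₁, f₂, y₁, y₂, hF, hone⟩⟩ := IsExplored.exists_walk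
    (Inv := fun W y => ∃ e f₁ f₂ y₂, IsFork G W e f₁ f₂ y y₂) (Halt := fun W _ => ForkHalts E S G W)
    hSV (fun _ _ ⟨_, _, _, _, hF⟩ => hG.forkHalts_or_exists_isLocalExtension hF) hstart
    ⟨e, f₁, f₂, y₂, hF⟩
  · refine ⟨_, s, by simp, hs, .inr ⟨?_, by simp [stageLength]⟩⟩
    norm_num [stageExponent_cons, stageExponent_nil, tripleScheme]
  · refine ⟨_, _, by simp, hs.attach hSV hT (mem_insert_self _ _), .inl ?_⟩
    norm_num [stageExponent_cons, stageExponent_nil, tripleScheme, hcard]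
  · exact hG.hasRareExploration_of_isFork hSV hs hF hone

end IsTripleSystem

end Triples

/-! ### Counting extensions -/

section Counting

variable {α : Type*} [DecidableEq α]

/-- A set of `m` vertices can be completed to an edge by at most `F m` single vertices. -/
def HasCompletionBound (E : Finset α → Prop) (F : ℕ → ℕ) : Prop :=
  ∀ Y : Finset α, ∃ C : Finset α, #C ≤ F #Y ∧
    ∀ g t, E g → t ∈ g → g ⊆ insert t Y → t ∈ C

variable {E : Finset α → Prop} {F : ℕ → ℕ} {V R : Finset α} {N k : ℕ}

lemma extensions_eq_empty (h : N < k) : extensions E V R N k = ∅ := by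
  refine eq_empty_of_forall_notMem fun T hT => ?_
  obtain ⟨-, hcard, hk⟩ := mem_extensions.1 hT
  have hkT : k ≤ #T :=
    hk.le_card_sdiff.trans (card_le_card (by rw [union_sdiff_left]; exact sdiff_subset))
  omega

lemma extensions_succ_subset {C : Finset α → Finset α}
    (hC : ∀ Y g t, E g → t ∈ g → g ⊆ insert t Y → t ∈ C Y) :
    extensions E V R (N + 1) (k + 1) ⊆
      (extensions E V R N k).biUnion fun T => (C (R ∪ T)).image fun t => insert t T := by
  intro T hT
  obtain ⟨hTV, hTcard, hchain⟩ := mem_extensions.1 hT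
  obtain ⟨t, htX, htR, hchain', g, hg, htg, hgX⟩ := hchain.exists_erase
  have htT : t ∈ T := (mem_union.1 htX).resolve_left htR
  have herase : (R ∪ T).erase t = R ∪ T.erase t := by
    rw [erase_union_distrib, erase_eq_of_notMem htR]
  refine mem_biUnion.2 ⟨T.erase t, mem_extensions.2 ⟨(erase_subset _ _).trans hTV, ?_,
    herase ▸ hchain'⟩, mem_image.2 ⟨t, ?_, insert_erase htT⟩⟩
  · rw [card_erase_of_mem htT, hTcard, Nat.add_sub_cancel]
  · exact hC _ g t hg htg (by rwa [← herase, insert_erase htX])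

-- Every edge of the chain determines one of the new vertices up to few choices.
lemma card_extensions_le (hE : HasCompletionBound E F) (hF : Monotone F) (V R : Finset α)
    (N k : ℕ) : #(extensions E V R N k) ≤ F (#R + N) ^ k * #V ^ (N - k) := by
  induction k generalizing N with
  | zero =>
    calc #(extensions E V R N 0) ≤ #(V.powersetCard N) :=
          card_le_card fun T hT => mem_powersetCard.2 ((mem_extensions.1 hT).imp_right And.left)
      _ ≤ F (#R + N) ^ 0 * #V ^ (N - 0) := by
        rw [card_powersetCard, pow_zero, one_mul, Nat.sub_zero]
        exact Nat.choose_le_pow _ _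
  | succ k ih =>
    obtain _ | N := N
    · simp [extensions_eq_empty (Nat.succ_pos k)]
    choose C hCcard hC using hE
    calc #(extensions E V R (N + 1) (k + 1))
        ≤ #(extensions E V R N k) * F (#R + (N + 1)) := by
          refine (card_le_card (extensions_succ_subset hC)).trans
            (card_biUnion_le_card_mul _ _ _ fun T hT => card_image_le.trans ((hCcard _).trans
              (hF ((card_union_le R T).trans ?_))))
          rw [(mem_extensions.1 hT).2.1]
          omega
      _ ≤ F (#R + (N + 1)) ^ k * #V ^ (N - k) * F (#R + (N + 1)) := by
          gcongr
          exact (ih N).trans (by gcongr; exact hF (by omega))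
      _ = F (#R + (N + 1)) ^ (k + 1) * #V ^ (N + 1 - (k + 1)) := by
          rw [Nat.add_sub_add_right]
          ring

lemma card_extensions_mul_pow_le (hE : HasCompletionBound E F) (hF : Monotone F)
    (hV : V.Nonempty) {q c β : ℝ} (hq0 : 0 ≤ q) (hc : 0 ≤ c) (hq : q ≤ c * (#V : ℝ) ^ (β - 1))
    (R : Finset α) (N k : ℕ) :
    (#(extensions E V R N k) : ℝ) * q ^ N ≤
      F (#R + N) ^ k * c ^ N * (#V : ℝ) ^ (β * N - k) := by
  have hVpos : (0 : ℝ) < #V := by exact_mod_cast hV.card_pos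
  rcases Nat.lt_or_ge N k with hNk | hkN
  · rw [extensions_eq_empty hNk, card_empty, Nat.cast_zero, zero_mul]
    positivity
  have hcard : (#(extensions E V R N k) : ℝ) ≤ F (#R + N) ^ k * (#V : ℝ) ^ (N - k) := by
    exact_mod_cast card_extensions_le hE hF V R N k
  have hpow : q ^ N ≤ c ^ N * (#V : ℝ) ^ ((β - 1) * N) := by
    calc q ^ N ≤ (c * (#V : ℝ) ^ (β - 1)) ^ N := pow_le_pow_left₀ hq0 hq N
      _ = _ := by rw [mul_pow, Real.rpow_mul hVpos.le, Real.rpow_natCast]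
  calc _ ≤ (F (#R + N) ^ k * (#V : ℝ) ^ (N - k)) * (c ^ N * (#V : ℝ) ^ ((β - 1) * N)) := by
        gcongr
    _ = F (#R + N) ^ k * c ^ N * ((#V : ℝ) ^ (N - k) * (#V : ℝ) ^ ((β - 1) * N)) := by ring
    _ = _ := by
        rw [← Real.rpow_natCast (#V : ℝ) (N - k), ← Real.rpow_add hVpos, Nat.cast_sub hkN]
        congr 2
        ring

end Counting

/-! ### Weights of families of explorations -/

section Weights

lemma sum_biUnion_le_sum_sum {ι κ : Type*} [DecidableEq κ] (s : Finset ι) (t : ι → Finset κ)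
    {f : κ → ℝ} (hf : ∀ x, 0 ≤ f x) : ∑ x ∈ s.biUnion t, f x ≤ ∑ i ∈ s, ∑ x ∈ t i, f x := by
  classical
  induction s using Finset.induction_on with
  | empty => simp
  | insert i s hi ih =>
    rw [biUnion_insert, sum_insert hi]
    have hunion := sum_union_inter (s₁ := t i) (s₂ := s.biUnion t) (f := f)
    have hinter : 0 ≤ ∑ x ∈ t i ∩ s.biUnion t, f x := sum_nonneg fun x _ => hf x
    linarith

variable {α : Type*}

/-- The expected number of members of a family that lie in a random set of density `q`. -/
def familyWeight (q : ℝ) (𝓕 : Finset (Finset α × α)) : ℝ :=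
  ∑ s ∈ 𝓕, q ^ #s.1

lemma familyWeight_nonneg {q : ℝ} (hq : 0 ≤ q) (𝓕 : Finset (Finset α × α)) :
    0 ≤ familyWeight q 𝓕 :=
  sum_nonneg fun _ _ => pow_nonneg hq _

variable [DecidableEq α] {E : Finset α → Prop} {F : ℕ → ℕ} {V : Finset α} {q c : ℝ} {N k M : ℕ}
  {𝓕 : Finset (Finset α × α)} {X : Finset α × α → Finset (Finset α)}
  {Y : Finset α × α → Finset α → Finset α}

lemma familyWeight_image_union {s : Finset α × α} {T : Finset α}
    (hd : Disjoint s.1 T) (Z : Finset α) :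
    familyWeight q (Z.image fun y => (s.1 ∪ T, y)) = #Z * (q ^ #T * q ^ #s.1) := by
  rw [familyWeight, sum_image fun _ _ _ _ h => (Prod.mk.inj h).2]
  simp only [card_union_of_disjoint hd, sum_const, nsmul_eq_mul, pow_add, mul_comm]

lemma familyWeight_attachAll_le (hq : 0 ≤ q) {κ m : ℝ} (hm : 0 ≤ m)
    (hN : ∀ s ∈ 𝓕, ∀ T ∈ X s, #T = N) (hX : ∀ s ∈ 𝓕, #(X s) * q ^ N ≤ κ)
    (hY : ∀ s ∈ 𝓕, ∀ T ∈ X s, #(Y s T) ≤ m) :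
    familyWeight q (attachAll X Y 𝓕) ≤ κ * m * familyWeight q 𝓕 := by
  have hpos : ∀ s : Finset α × α, 0 ≤ q ^ #s.1 := fun s => pow_nonneg hq _
  rw [familyWeight, familyWeight, mul_sum]
  refine (sum_biUnion_le_sum_sum _ _ hpos).trans (sum_le_sum fun s hs => ?_)
  calc _ ≤ ∑ _ ∈ (X s).filter (Disjoint s.1), m * (q ^ N * q ^ #s.1) := by
        refine (sum_biUnion_le_sum_sum _ _ hpos).trans (sum_le_sum fun T hT => ?_)
        obtain ⟨hT, hd⟩ := mem_filter.1 hT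
        refine (familyWeight_image_union hd (Y s T)).trans_le ?_
        rw [hN s hs T hT]
        exact mul_le_mul_of_nonneg_right (hY s hs T hT) (by positivity)
    _ = (#((X s).filter (Disjoint s.1)) * q ^ N) * m * q ^ #s.1 := by
        rw [sum_const, nsmul_eq_mul]
        ring
    _ ≤ κ * m * q ^ #s.1 := by
        gcongr
        refine le_trans ?_ (hX s hs)
        gcongr
        exact filter_subset _ _

lemma card_le_of_mem_attachAll (hN : ∀ s ∈ 𝓕, ∀ T ∈ X s, #T = N) (h𝓕 : ∀ s ∈ 𝓕, #s.1 ≤ M) :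
    ∀ s ∈ attachAll X Y 𝓕, #s.1 ≤ M + N := by
  intro t ht
  obtain ⟨s, hs, T, hT, -, y, -, rfl⟩ := mem_attachAll.1 ht
  exact (card_union_le _ _).trans (Nat.add_le_add (h𝓕 s hs) (hN s hs T hT).le)

lemma card_le_of_mem_globalStep (h𝓕 : ∀ s ∈ 𝓕, #s.1 ≤ M) :
    ∀ s ∈ globalStep E V N k 𝓕, #s.1 ≤ M + N :=
  card_le_of_mem_attachAll (fun _ _ _ hT => (mem_extensions.1 hT).2.1) h𝓕

lemma card_le_of_mem_iterate_localStep (h𝓕 : ∀ s ∈ 𝓕, #s.1 ≤ M) (i : ℕ) :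
    ∀ s ∈ (localStep E V N k)^[i] 𝓕, #s.1 ≤ M + i * N := by
  induction i with
  | zero => simpa using h𝓕
  | succ i ih =>
    rw [Function.iterate_succ_apply', Nat.succ_mul, ← add_assoc]
    exact card_le_of_mem_attachAll (fun _ _ _ hT => (mem_extensions.1 hT).2.1) ih

lemma familyWeight_globalStep_le (hE : HasCompletionBound E F) (hF : Monotone F)
    (hV : V.Nonempty) {β : ℝ} (hq0 : 0 ≤ q) (hc0 : 0 ≤ c) (hc1 : c ≤ 1)
    (hq : q ≤ c * (#V : ℝ) ^ (β - 1)) {D : ℕ} (hk : k ≤ D) (h𝓕 : ∀ s ∈ 𝓕, #s.1 + N ≤ M) :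
    familyWeight q (globalStep E V N k 𝓕) ≤
      ((F M : ℝ) + 1) ^ D * (M + 1) * (#V : ℝ) ^ (β * N - k) * familyWeight q 𝓕 := by
  refine (familyWeight_attachAll_le (N := N) (m := (M : ℝ) + 1)
    (κ := ((F M : ℝ) + 1) ^ D * (#V : ℝ) ^ (β * N - k)) hq0 (by positivity)
    (fun s _ T hT => (mem_extensions.1 hT).2.1) ?_ ?_).trans_eq (by ring)
  · intro s hs
    refine (card_extensions_mul_pow_le hE hF hV hq0 hc0 hq s.1 N k).trans ?_
    have hF' : (F (#s.1 + N) : ℝ) ≤ F M := by exact_mod_cast hF (h𝓕 s hs)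
    gcongr
    calc (F (#s.1 + N) : ℝ) ^ k * c ^ N ≤ ((F M : ℝ) + 1) ^ k * 1 := by
          gcongr
          · linarith
          · exact pow_le_one₀ hc0 hc1
      _ ≤ ((F M : ℝ) + 1) ^ D := by
          rw [mul_one]
          exact pow_le_pow_right₀ (by linarith [(F M).cast_nonneg (α := ℝ)]) hk
  · intro s hs T hT
    have hinsert := card_insert_le s.2 (s.1 ∪ T)
    have hunion := card_union_le s.1 T
    rw [(mem_extensions.1 hT).2.1] at hunion
    have := h𝓕 s hs
    exact_mod_cast (by omega : #(insert s.2 (s.1 ∪ T)) ≤ M + 1)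

/-- At density at most `c * n ^ (P.density - 1)` a local step halves the weight of a family: its
exponent vanishes, and `c` is small. -/
structure IsSubcritical (P : Scheme) (F : ℕ → ℕ) (c : ℝ) : Prop where
  nonneg : 0 ≤ c
  le_one : c ≤ 1
  density_mul : P.density * P.stepSize = P.stepEdges
  le_half : (F (1 + P.stepSize) : ℝ) ^ P.stepEdges * c ^ P.stepSize * P.stepSize ≤ 1 / 2

lemma exists_isSubcritical {P : Scheme} (hP : P.density * P.stepSize = P.stepEdges)
    (hN : 1 ≤ P.stepSize) (F : ℕ → ℕ) : ∃ c : ℝ, 0 < c ∧ IsSubcritical P F c := by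
  set K : ℝ := (F (1 + P.stepSize) : ℝ) ^ P.stepEdges
  set c : ℝ := 1 / (2 * (K * P.stepSize + 1)) with hc
  have hc1 : c ≤ 1 := by
    rw [hc, div_le_one (by positivity)]
    linarith [show 0 ≤ K * P.stepSize by positivity]
  refine ⟨c, by positivity, by positivity, hc1, hP, ?_⟩
  calc K * c ^ P.stepSize * P.stepSize ≤ K * c * P.stepSize := by
        gcongr
        exact pow_le_of_le_one (by positivity) hc1 (by omega)
    _ = K * P.stepSize / (K * P.stepSize + 1) / 2 := by rw [hc]; field_simp
    _ ≤ 1 / 2 := by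
        gcongr
        rw [div_le_one (by positivity)]
        linarith

variable {P : Scheme} {L : ℕ} {l : List Stage}

lemma familyWeight_localStep_le (hE : HasCompletionBound E F) (hF : Monotone F)
    (hc : IsSubcritical P F c) (hV : V.Nonempty) (hq0 : 0 ≤ q)
    (hq : q ≤ c * (#V : ℝ) ^ (P.density - 1)) (𝓕 : Finset (Finset α × α)) :
    familyWeight q (localStep E V P.stepSize P.stepEdges 𝓕) ≤ 1 / 2 * familyWeight q 𝓕 := by
  refine (familyWeight_attachAll_le (N := P.stepSize) (m := P.stepSize)
    (κ := (F (1 + P.stepSize) : ℝ) ^ P.stepEdges * c ^ P.stepSize) hq0 (Nat.cast_nonneg _)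
    (fun s _ T hT => (mem_extensions.1 hT).2.1) (fun s _ => ?_) fun s _ T hT => ?_).trans
    (mul_le_mul_of_nonneg_right hc.le_half (familyWeight_nonneg hq0 𝓕))
  · refine (card_extensions_mul_pow_le hE hF hV hq0 hc.nonneg hq {s.2} _ _).trans_eq ?_
    rw [hc.density_mul, sub_self, Real.rpow_zero, mul_one, card_singleton]
  · rw [(mem_extensions.1 hT).2.1]

lemma familyWeight_iterate_localStep_le (hE : HasCompletionBound E F) (hF : Monotone F)
    (hc : IsSubcritical P F c) (hV : V.Nonempty) (hq0 : 0 ≤ q)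
    (hq : q ≤ c * (#V : ℝ) ^ (P.density - 1)) (𝓕 : Finset (Finset α × α)) (i : ℕ) :
    familyWeight q ((localStep E V P.stepSize P.stepEdges)^[i] 𝓕) ≤
      (1 / 2) ^ i * familyWeight q 𝓕 := by
  induction i with
  | zero => simp
  | succ i ih =>
    rw [Function.iterate_succ_apply', pow_succ', mul_assoc]
    exact (familyWeight_localStep_le hE hF hc hV hq0 hq _).trans
      (mul_le_mul_of_nonneg_left ih (by norm_num))

variable [Inhabited α]

lemma card_le_of_mem_explorations (hl : IsBoundedBy P L l) :
    ∀ s ∈ explorations P E V l, #s.1 ≤ l.length * (P.maxSize + L * P.stepSize) := by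
  induction l with
  | nil => simp [explorations]
  | cons σ l ih =>
    obtain ⟨⟨hsize, -, hlen⟩, hl⟩ := List.forall_mem_cons.1 hl
    intro s hs
    refine (card_le_of_mem_iterate_localStep (card_le_of_mem_globalStep (ih hl)) σ.len s hs).trans
      ?_
    have := Nat.mul_le_mul_right P.stepSize hlen
    rw [List.length_cons, Nat.succ_mul]
    omega

lemma familyWeight_explorations_le (hE : HasCompletionBound E F) (hF : Monotone F)
    (hc : IsSubcritical P F c) (hV : V.Nonempty) (hq0 : 0 ≤ q)
    (hq : q ≤ c * (#V : ℝ) ^ (P.density - 1)) (hl : IsBoundedBy P L l)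
    (hM : l.length * (P.maxSize + L * P.stepSize) ≤ M) :
    familyWeight q (explorations P E V l) ≤
      (((F M : ℝ) + 1) ^ P.maxSize * (M + 1)) ^ l.length * (#V : ℝ) ^ stageExponent P l *
        (1 / 2) ^ stageLength l := by
  have hVpos : (0 : ℝ) < #V := by exact_mod_cast hV.card_pos
  induction l with
  | nil => simp [explorations, familyWeight, stageExponent, stageLength]
  | cons σ l ih =>
    obtain ⟨⟨hsize, hedges, -⟩, hl⟩ := List.forall_mem_cons.1 hl
    rw [List.length_cons, Nat.succ_mul] at hM
    have hglobal := familyWeight_globalStep_le (N := σ.size) (M := M) hE hF hV hq0 hc.nonneg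
      hc.le_one hq hedges (𝓕 := explorations P E V l) fun s hs => by
        have := card_le_of_mem_explorations hl s hs
        omega
    refine (familyWeight_iterate_localStep_le hE hF hc hV hq0 hq _ σ.len).trans ?_
    set Q := ((F M : ℝ) + 1) ^ P.maxSize * (M + 1)
    calc _ ≤ (1 / 2) ^ σ.len * (Q * (#V : ℝ) ^ (P.density * σ.size - σ.edges) *
          (Q ^ l.length * (#V : ℝ) ^ stageExponent P l * (1 / 2) ^ stageLength l)) := by
          gcongr
          refine hglobal.trans ?_
          gcongr
          exact ih hl (by omega)
      _ = _ := by
          rw [stageExponent_cons, stageLength_cons, Real.rpow_add hVpos, List.length_cons]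
          ring

end Weights

/-! ### The union bound -/

section Shapes

open Classical in
/-- The lists of at most `r` stages with at most `D` vertices, `D` edges and `L` local steps. -/
noncomputable def shapes (D L : ℕ) : ℕ → Finset (List Stage)
  | 0 => {[]}
  | r + 1 => insert [] ((range (D + 1) ×ˢ range (D + 1) ×ˢ range (L + 1) ×ˢ shapes D L r).image
      fun x => ⟨x.1, x.2.1, x.2.2.1⟩ :: x.2.2.2)

lemma card_shapes_le (D L r : ℕ) : #(shapes D L r) ≤ ((D + 1) ^ 2 * (L + 1) + 1) ^ r := by
  classical
  induction r with
  | zero => simp [shapes]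
  | succ r ih =>
    set K := (D + 1) ^ 2 * (L + 1)
    calc #(shapes D L (r + 1)) ≤ K * #(shapes D L r) + 1 := by
          refine (card_insert_le _ _).trans (Nat.succ_le_succ (card_image_le.trans_eq ?_))
          simp only [card_product, card_range, K]
          ring
      _ ≤ K * (K + 1) ^ r + (K + 1) ^ r := by
          gcongr
          exact Nat.one_le_pow _ _ K.succ_pos
      _ = (K + 1) ^ (r + 1) := by ring

variable {P : Scheme} {L r : ℕ} {l : List Stage}

lemma mem_shapes (hl : IsBoundedBy P L l) (hr : l.length ≤ r) : l ∈ shapes P.maxSize L r := by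
  classical
  induction r generalizing l with
  | zero => simpa [shapes] using hr
  | succ r ih =>
    obtain _ | ⟨σ, l⟩ := l
    · exact mem_insert_self _ _
    obtain ⟨⟨hsize, hedges, hlen⟩, hl⟩ := List.forall_mem_cons.1 hl
    refine mem_insert_of_mem (mem_image.2 ⟨(σ.size, σ.edges, σ.len, l), ?_, rfl⟩)
    simp only [mem_product, mem_range, Nat.lt_succ_iff]
    exact ⟨hsize, hedges, hlen, ih hl (by simpa using hr)⟩

lemma exists_stageExponent_eq (hl : IsBoundedBy P L l) :
    ∃ N ≤ l.length * P.maxSize, ∃ k ≤ l.length * P.maxSize,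
      stageExponent P l = P.density * N - k := by
  induction l with
  | nil => exact ⟨0, by simp, 0, by simp, by simp [stageExponent_nil]⟩
  | cons σ l ih =>
    obtain ⟨⟨hsize, hedges, -⟩, hl⟩ := List.forall_mem_cons.1 hl
    obtain ⟨N, hN, k, hk, h⟩ := ih hl
    rw [List.length_cons, Nat.succ_mul]
    refine ⟨N + σ.size, by omega, k + σ.edges, by omega, ?_⟩
    rw [stageExponent_cons, h]
    push_cast
    ring

lemma exists_neg_gap (s : Finset ℝ) : ∃ ε > 0, ∀ x ∈ s, x < 0 → x ≤ -ε := by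
  have h : ∀ᶠ ε in 𝓝[>] (0 : ℝ), ∀ x ∈ s, x < 0 → x ≤ -ε := by
    refine (eventually_all_finset s).2 fun x _ => eventually_imp_distrib_left.2 fun hx => ?_
    filter_upwards [nhdsWithin_le_nhds (Iio_mem_nhds (neg_pos.2 hx))] with ε hε
    linarith [Set.mem_Iio.1 hε]
  obtain ⟨ε, h, hε⟩ := (h.and self_mem_nhdsWithin).exists
  exact ⟨ε, hε, h⟩

lemma exists_stageExponent_gap (P : Scheme) (r : ℕ) :
    ∃ ε > 0, ∀ L l, IsBoundedBy P L l → l.length ≤ r → stageExponent P l < 0 →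
      stageExponent P l ≤ -ε := by
  let I := range (r * P.maxSize + 1)
  obtain ⟨ε, hε, hgap⟩ := exists_neg_gap ((I ×ˢ I).image fun x => P.density * x.1 - x.2)
  refine ⟨ε, hε, fun L l hl hr hneg => hgap _ ?_ hneg⟩
  obtain ⟨N, hN, k, hk, h⟩ := exists_stageExponent_eq hl
  have hI : ∀ m ≤ l.length * P.maxSize, m ∈ I := fun m hm =>
    mem_range.2 (Nat.lt_succ_of_le (hm.trans (Nat.mul_le_mul_right _ hr)))
  exact mem_image.2 ⟨(N, k), mem_product.2 ⟨hI N hN, hI k hk⟩, h.symm⟩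

end Shapes

section UnionBound

open MeasureTheory

lemma setBernoulli_superset_le {ι : Type*} (u : Set ι) (p : unitInterval) (W : Finset ι) :
    setBernoulli u p {S : Set ι | (W : Set ι) ⊆ S} ≤ ENNReal.ofReal ((p : ℝ) ^ #W) := by
  have hprod : setBernoulli u p {S : Set ι | (W : Set ι) ⊆ S} =
      ∏ i ∈ W, (unitInterval.toNNReal p • Measure.dirac (i ∈ u) +
        unitInterval.toNNReal (unitInterval.symm p) • Measure.dirac False) {True} := by
    rw [setBernoulli_apply', ← Measure.infinitePi_pi _ fun i _ => MeasurableSet.singleton _]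
    congr 1
    ext s
    simp [Set.subset_def]
  have hdirac (i : ι) : Measure.dirac (i ∈ u) {True} ≤ 1 := prob_le_one
  have hfalse : Measure.dirac False {True} = 0 :=
    (Measure.dirac_apply' _ (MeasurableSet.singleton _)).trans (by simp)
  have hp : ENNReal.ofReal (p : ℝ) = unitInterval.toNNReal p :=
    ENNReal.ofReal_coe_nnreal (p := unitInterval.toNNReal p)
  rw [hprod, ENNReal.ofReal_pow p.2.1, ← prod_const, hp]
  refine prod_le_prod' fun i _ => ?_
  rw [Measure.add_apply, Measure.smul_apply, Measure.smul_apply, hfalse, smul_zero, add_zero,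
    ENNReal.smul_def, smul_eq_mul]
  exact mul_le_of_le_one_right' (hdirac i)

lemma half_pow_log_le_inv {n : ℕ} (hn : 1 ≤ n) : ((1 : ℝ) / 2) ^ (Nat.log 2 n + 1) ≤ (n : ℝ)⁻¹ := by
  rw [one_div, inv_pow]
  refine inv_anti₀ (by exact_mod_cast hn) ?_
  exact_mod_cast (Nat.lt_pow_succ_log_self (by norm_num) n).le

lemma rpow_stageExponent_mul_half_pow_le {P : Scheme} {l : List Stage} {n : ℕ} {ε : ℝ}
    (hn : 1 ≤ n) (hε1 : ε ≤ 1 - P.slack)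
    (hε : stageExponent P l < 0 → stageExponent P l ≤ -ε)
    (hl : stageExponent P l < 0 ∨
      stageExponent P l ≤ P.slack ∧ Nat.log 2 n + 1 ≤ stageLength l) :
    (n : ℝ) ^ stageExponent P l * (1 / 2) ^ stageLength l ≤ (n : ℝ) ^ (-ε) := by
  have hn1 : (1 : ℝ) ≤ n := by exact_mod_cast hn
  rcases hl with hneg | ⟨hslack, hlen⟩
  · refine (mul_le_of_le_one_right (by positivity)
      (pow_le_one₀ (by norm_num) (by norm_num))).trans ?_
    exact Real.rpow_le_rpow_of_exponent_le hn1 (hε hneg)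
  · calc (n : ℝ) ^ stageExponent P l * (1 / 2) ^ stageLength l
        ≤ (n : ℝ) ^ P.slack * (n : ℝ)⁻¹ := by
          gcongr
          exact (pow_le_pow_of_le_one (by norm_num) (by norm_num) hlen).trans
            (half_pow_log_le_inv hn)
      _ = (n : ℝ) ^ (P.slack - 1) := by
          rw [Real.rpow_sub_one (by positivity), div_eq_mul_inv]
      _ ≤ (n : ℝ) ^ (-ε) := Real.rpow_le_rpow_of_exponent_le hn1 (by linarith)

variable {α : Type*} [DecidableEq α] [Inhabited α] {P : Scheme} {E : Finset α → Prop} {F : ℕ → ℕ}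
  {V : Finset α} {c q ε : ℝ} {L M : ℕ} {l : List Stage}

/-- The sets that contain a finite set with a rare exploration of logarithmic length. -/
def rareSets (P : Scheme) (E : Finset α → Prop) (V : Finset α) : Set (Set α) :=
  {S | ∃ T : Finset α, (T : Set α) ⊆ S ∧ HasRareExploration P E V (Nat.log 2 #V + 1) T}

lemma familyWeight_rare_le (hE : HasCompletionBound E F) (hF : Monotone F)
    (hc : IsSubcritical P F c) (hV : V.Nonempty) (hq0 : 0 ≤ q)
    (hq : q ≤ c * (#V : ℝ) ^ (P.density - 1)) (hε1 : ε ≤ 1 - P.slack)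
    (hε : stageExponent P l < 0 → stageExponent P l ≤ -ε) (hl : IsBoundedBy P L l)
    (hlen : l.length ≤ 3) (hM : 3 * (P.maxSize + L * P.stepSize) ≤ M)
    (hrare : stageExponent P l < 0 ∨
      stageExponent P l ≤ P.slack ∧ Nat.log 2 #V + 1 ≤ stageLength l) :
    familyWeight q (explorations P E V l) ≤
      (((F M : ℝ) + 1) ^ P.maxSize * (M + 1)) ^ 3 * (#V : ℝ) ^ (-ε) := by
  refine (familyWeight_explorations_le hE hF hc hV hq0 hq hl
    ((Nat.mul_le_mul_right _ hlen).trans hM)).trans ?_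
  rw [mul_assoc]
  refine mul_le_mul (pow_le_pow_right₀ ?_ hlen)
    (rpow_stageExponent_mul_half_pow_le hV.card_pos hε1 hε hrare) (by positivity) (by positivity)
  exact one_le_mul_of_one_le_of_one_le
    (one_le_pow₀ (by linarith [(F M).cast_nonneg (α := ℝ)]))
    (by linarith [M.cast_nonneg (α := ℝ)])

lemma setBernoulli_rareSets_le (hE : HasCompletionBound E F) (hF : Monotone F)
    (hc : IsSubcritical P F c) (hV : V.Nonempty) (p : unitInterval)
    (hp : (p : ℝ) ≤ c * (#V : ℝ) ^ (P.density - 1)) (hε1 : ε ≤ 1 - P.slack)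
    (hε : ∀ L l, IsBoundedBy P L l → l.length ≤ 3 → stageExponent P l < 0 →
      stageExponent P l ≤ -ε) (hL : L = Nat.log 2 #V + 1)
    (hM : 3 * (P.maxSize + L * P.stepSize) ≤ M) (u : Set α) :
    setBernoulli u p (rareSets P E V) ≤
      ENNReal.ofReal ((((P.maxSize : ℝ) + 1) ^ 2 * (L + 1) + 1) ^ 3 *
        ((((F M : ℝ) + 1) ^ P.maxSize * (M + 1)) ^ 3 * (#V : ℝ) ^ (-ε))) := by
  classical
  set B := (((F M : ℝ) + 1) ^ P.maxSize * (M + 1)) ^ 3 * (#V : ℝ) ^ (-ε)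
  have hB : 0 ≤ B := by positivity
  let I := (shapes P.maxSize L 3).filter fun l => l.length ≤ 3 ∧ IsBoundedBy P L l ∧
    (stageExponent P l < 0 ∨ stageExponent P l ≤ P.slack ∧ L ≤ stageLength l)
  have hI : (#I : ℝ) ≤ (((P.maxSize : ℝ) + 1) ^ 2 * (L + 1) + 1) ^ 3 := by
    exact_mod_cast (card_filter_le _ _).trans (card_shapes_le P.maxSize L 3)
  have hcover : rareSets P E V ⊆
      ⋃ l ∈ I, ⋃ s ∈ explorations P E V l, {S : Set α | (s.1 : Set α) ⊆ S} := by
    rintro S ⟨T, hTS, l, s, hlen, hs, hrare⟩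
    rw [← hL] at hs hrare
    simp only [Set.mem_iUnion]
    exact ⟨l, mem_filter.2 ⟨mem_shapes hs.bounded hlen, hlen, hs.bounded, hrare⟩, s, hs.mem,
      (coe_subset.2 hs.subset).trans hTS⟩
  have hweight : ∀ l ∈ I, familyWeight p (explorations P E V l) ≤ B := by
    intro l hl
    obtain ⟨-, hlen, hbounded, hrare⟩ := mem_filter.1 hl
    exact familyWeight_rare_le hE hF hc hV p.2.1 hp hε1 (hε L l hbounded hlen) hbounded hlen hM
      (hL ▸ hrare)
  calc _ ≤ ∑ l ∈ I, ∑ s ∈ explorations P E V l, setBernoulli u p {S : Set α | (s.1 : Set α) ⊆ S} :=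
        (measure_mono hcover).trans ((measure_biUnion_finset_le _ _).trans
          (sum_le_sum fun l _ => measure_biUnion_finset_le _ _))
    _ ≤ ∑ _ ∈ I, ENNReal.ofReal B := by
        refine sum_le_sum fun l hl => ?_
        refine (sum_le_sum fun s _ => setBernoulli_superset_le _ _ _).trans ?_
        rw [← ENNReal.ofReal_sum_of_nonneg fun s _ => pow_nonneg p.2.1 _]
        exact ENNReal.ofReal_le_ofReal (hweight l hl)
    _ = ENNReal.ofReal (#I * B) := by
        rw [sum_const, nsmul_eq_mul, ENNReal.ofReal_mul (Nat.cast_nonneg _),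
          ENNReal.ofReal_natCast]
    _ ≤ _ := ENNReal.ofReal_le_ofReal (mul_le_mul_of_nonneg_right hI hB)

end UnionBound

section Limit

open Polynomial

lemma natLog_isBigO_log : (fun n : ℕ => (Nat.log 2 n : ℝ)) =O[atTop] fun n : ℕ => Real.log n := by
  refine Asymptotics.IsBigO.of_bound (Real.log 2)⁻¹ ?_
  filter_upwards [eventually_ge_atTop 1] with n hn
  have hlog2 : 0 < Real.log 2 := Real.log_pos one_lt_two
  have hn1 : (1 : ℝ) ≤ n := by exact_mod_cast hn
  rw [Real.norm_of_nonneg (Nat.cast_nonneg _), Real.norm_of_nonneg (Real.log_nonneg hn1),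
    inv_mul_eq_div, le_div_iff₀ hlog2, ← Real.log_pow]
  exact Real.log_le_log (by positivity) (by exact_mod_cast Nat.pow_log_le_self 2 (by omega))

lemma tendsto_natLog_atTop : Tendsto (fun n : ℕ => (Nat.log 2 n : ℝ)) atTop atTop := by
  refine tendsto_natCast_atTop_atTop.comp (tendsto_atTop.2 fun b => ?_)
  filter_upwards [eventually_ge_atTop (2 ^ b)] with n hn
  exact Nat.le_log_of_pow_le one_lt_two hn

lemma tendsto_eval_natLog_mul_rpow_neg (f : ℝ[X]) {ε : ℝ} (hε : 0 < ε) :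
    Tendsto (fun n : ℕ => f.eval (Nat.log 2 n : ℝ) * (n : ℝ) ^ (-ε)) atTop (𝓝 0) := by
  have hf : (fun x : ℝ => f.eval x) =O[atTop] fun x => x ^ f.natDegree := by
    simpa using f.isBigO_atTop_of_degree_le (Q := X ^ f.natDegree) (by simp [degree_le_natDegree])
  have hlog := (isLittleO_log_rpow_rpow_atTop (f.natDegree : ℝ) hε).comp_tendsto
    tendsto_natCast_atTop_atTop (k := fun n : ℕ => (n : ℝ))
  simp only [Function.comp_def, Real.rpow_natCast] at hlog
  have h := ((hf.comp_tendsto tendsto_natLog_atTop).trans (natLog_isBigO_log.pow _)).trans_isLittleO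
    hlog
  refine h.tendsto_div_nhds_zero.congr fun n => ?_
  rw [Real.rpow_neg n.cast_nonneg, div_eq_mul_inv, Function.comp_apply]

variable {α : Type*} [DecidableEq α] [Inhabited α] {P : Scheme} {E : Finset α → Prop} {F : ℕ → ℕ}
  {V : ℕ → Finset α} {c : ℝ}

theorem tendsto_setBernoulli_rareSets (hE : HasCompletionBound E F) (hF : Monotone F)
    {f : ℝ[X]} (hf : ∀ m : ℕ, (F m : ℝ) = f.eval (m : ℝ)) (hc : IsSubcritical P F c)
    (hP : P.slack < 1) (hV : ∀ n, #(V n) = n) {p : ℕ → unitInterval}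
    (hp : ∀ᶠ n : ℕ in atTop, (p n : ℝ) ≤ c * (n : ℝ) ^ (P.density - 1)) :
    Tendsto (fun n => setBernoulli (V n : Set α) (p n) (rareSets P E (V n))) atTop (𝓝 0) := by
  obtain ⟨ε₀, hε₀, hgap⟩ := exists_stageExponent_gap P 3
  set ε := min ε₀ (1 - P.slack)
  have hε : 0 < ε := lt_min hε₀ (sub_pos.2 hP)
  let M : ℝ[X] := 3 * (C (P.maxSize : ℝ) + (X + 1) * C (P.stepSize : ℝ))
  let K : ℝ[X] := ((C (P.maxSize : ℝ) + 1) ^ 2 * (X + 1 + 1) + 1) ^ 3 *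
    ((f.comp M + 1) ^ P.maxSize * (M + 1)) ^ 3
  have hlim := ENNReal.tendsto_ofReal (tendsto_eval_natLog_mul_rpow_neg K hε)
  rw [ENNReal.ofReal_zero] at hlim
  refine tendsto_of_tendsto_of_tendsto_of_le_of_le' tendsto_const_nhds hlim
    (Eventually.of_forall fun _ => zero_le) ?_
  filter_upwards [hp, eventually_ge_atTop 1] with n hpn hn
  refine (setBernoulli_rareSets_le hE hF hc (card_pos.1 ((hV n).symm ▸ hn)) (p n)
    ((hV n).symm ▸ hpn) (min_le_right _ _) (fun L l hl hlen hneg => (hgap L l hl hlen hneg).trans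
      (neg_le_neg (min_le_left _ _))) rfl le_rfl _).trans_eq ?_
  rw [hV, ← mul_assoc, hf]
  simp [K, M, ε]

end Limit

/-! ### Solutions of linear equations -/

section Solutions

namespace LinearEquation

variable {k : ℕ} {A : LinearEquation k} {g : Finset ℤ}

/-- The set `g` is the set of entries of a `k`-distinct solution of `A`. -/
def IsSolutionSet (A : LinearEquation k) (g : Finset ℤ) : Prop :=
  ∃ x : Fin k → ℤ, A.IsDistinctSolution x ∧ univ.image x = g

lemma IsSolutionSet.card_eq (h : A.IsSolutionSet g) : #g = k := by
  obtain ⟨x, ⟨-, hx⟩, rfl⟩ := h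
  rw [card_image_of_injective _ hx, card_univ, Fintype.card_fin]

lemma rhs_sub_sum_update_zero {x : Fin k → ℤ} (hx : A.IsDistinctSolution x) (j : Fin k) :
    A.rhs - ∑ i, A.coeff i * Function.update x j 0 i = A.coeff j * x j := by
  rw [← hx.1, ← sum_sub_distrib, Fintype.sum_eq_single j]
  · simp
  · intro i hij
    rw [Function.update_of_ne hij, sub_self]

-- All entries of a solution but one determine the remaining one, as its coefficient is nonzero.
lemma hasCompletionBound (A : LinearEquation k) :
    HasCompletionBound A.IsSolutionSet fun m => k * (m + 1) ^ k := by
  intro Y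
  refine ⟨((univ : Finset (Fin k)) ×ˢ Fintype.piFinset fun _ => insert 0 Y).image
    fun q => (A.rhs - ∑ i, A.coeff i * q.2 i) / A.coeff q.1, ?_, ?_⟩
  · refine card_image_le.trans ?_
    rw [card_product, card_univ, Fintype.card_fin, Fintype.card_piFinset_const]
    exact Nat.mul_le_mul_left _ (Nat.pow_le_pow_left (card_insert_le 0 Y) _)
  · rintro g t ⟨x, hx, rfl⟩ ht hsub
    obtain ⟨j, -, rfl⟩ := mem_image.1 ht
    have hmem : ∀ i, Function.update x j 0 i ∈ insert 0 Y := fun i => by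
      obtain rfl | hij := eq_or_ne i j
      · rw [Function.update_self]
        exact mem_insert_self _ _
      · rw [Function.update_of_ne hij]
        exact mem_insert_of_mem (mem_of_mem_insert_of_ne
          (hsub (mem_image_of_mem x (mem_univ i))) (hx.2.ne hij))
    refine mem_image.2 ⟨(j, Function.update x j 0),
      mem_product.2 ⟨mem_univ _, Fintype.mem_piFinset.2 hmem⟩, ?_⟩
    rw [rhs_sub_sum_update_zero hx]
    exact Int.mul_ediv_cancel_left _ (A.coeff_ne_zero j)

end LinearEquation

variable {kA kB : ℕ}

/-- The set `g` is the set of entries of a distinct solution of `A` or of `B`: these are the edges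
of the explorations. -/
def IsSolutionEdge (A : LinearEquation kA) (B : LinearEquation kB) (g : Finset ℤ) : Prop :=
  A.IsSolutionSet g ∨ B.IsSolutionSet g

/-- The bound on the number of completions of a set of `m` integers to an edge. -/
def completionBound (kA kB m : ℕ) : ℕ :=
  kA * (m + 1) ^ kA + kB * (m + 1) ^ kB

lemma monotone_completionBound (kA kB : ℕ) : Monotone (completionBound kA kB) := fun _ _ h => by
  simp only [completionBound]
  gcongr

open Polynomial in
lemma cast_completionBound (kA kB m : ℕ) :
    (completionBound kA kB m : ℝ) =
      ((kA : ℝ[X]) * (X + 1) ^ kA + (kB : ℝ[X]) * (X + 1) ^ kB).eval (m : ℝ) := by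
  simp [completionBound]

lemma hasCompletionBound_isSolutionEdge (A : LinearEquation kA) (B : LinearEquation kB) :
    HasCompletionBound (IsSolutionEdge A B) (completionBound kA kB) := by
  intro Y
  obtain ⟨CA, hCA, hA⟩ := A.hasCompletionBound Y
  obtain ⟨CB, hCB, hB⟩ := B.hasCompletionBound Y
  refine ⟨CA ∪ CB, (card_union_le _ _).trans (Nat.add_le_add hCA hCB), fun g t hg ht hs => ?_⟩
  exact mem_union.2 (hg.imp (hA g t · ht hs) (hB g t · ht hs))

end Solutions

/-! ### Rado sets have rare explorations -/

section Rado

variable {kA kB : ℕ} {A : LinearEquation kA} {B : LinearEquation kB}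
  {S V : Finset ℤ} {FA FB : Finset (Finset ℤ)} {L : ℕ}

open Classical in
lemma IsRado.isUncolourable (h : IsRado A B (S : Set ℤ)) :
    IsUncolourable (S.powerset.filter A.IsSolutionSet) (S.powerset.filter B.IsSolutionSet) := by
  have hmem {k : ℕ} {D : LinearEquation k} {x : Fin k → (S : Set ℤ)}
      (hx : D.IsDistinctSolution fun i => (x i : ℤ)) :
      (univ.image fun i => (x i : ℤ)) ∈ S.powerset.filter D.IsSolutionSet :=
    mem_filter.2 ⟨mem_powerset.2 (image_subset_iff.2 fun i _ => (x i).2), _, hx, rfl⟩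
  intro C
  rcases h fun s => if (s : ℤ) ∈ C then .red else .blue with ⟨x, hx, hred⟩ | ⟨x, hx, hblue⟩
  · refine .inl ⟨_, hmem hx, ?_⟩
    simpa [Set.range_subset_iff] using hred
  · refine .inr ⟨_, hmem hx, ?_⟩
    simpa [Set.range_subset_iff] using hblue

/-- The families `FA` and `FB` form a minimal uncolourable pair of sets of solutions of `A` and of
`B` in `S`. -/
structure IsObstruction (A : LinearEquation kA) (B : LinearEquation kB) (S : Finset ℤ)
    (FA FB : Finset (Finset ℤ)) : Prop where
  minimal : IsMinimalUncolourable FA FB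
  subset_left : ∀ e ∈ FA, e ⊆ S
  subset_right : ∀ f ∈ FB, f ⊆ S
  isSolutionSet_left : ∀ e ∈ FA, A.IsSolutionSet e
  isSolutionSet_right : ∀ f ∈ FB, B.IsSolutionSet f

lemma IsRado.exists_isObstruction (h : IsRado A B (S : Set ℤ)) :
    ∃ FA FB, IsObstruction A B S FA FB := by
  classical
  obtain ⟨FA, hFA, FB, hFB, hmin⟩ := h.isUncolourable.exists_minimal
  exact ⟨FA, FB, hmin, fun e he => mem_powerset.1 (mem_filter.1 (hFA he)).1,
    fun f hf => mem_powerset.1 (mem_filter.1 (hFB hf)).1,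
    fun e he => (mem_filter.1 (hFA he)).2, fun f hf => (mem_filter.1 (hFB hf)).2⟩

namespace IsObstruction

lemma isCrossing (h : IsObstruction A B S FA FB) :
    IsCrossing (IsSolutionEdge A B) S kA kB FA FB where
  isEdge_left e he := .inl (h.isSolutionSet_left e he)
  isEdge_right f hf := .inr (h.isSolutionSet_right f hf)
  subset_left := h.subset_left
  subset_right := h.subset_right
  card_left e he := (h.isSolutionSet_left e he).card_eq
  card_right f hf := (h.isSolutionSet_right f hf).card_eq
  cross_left _ he _ hx := h.minimal.exists_inter_eq_singleton he hx
  cross_right f hf _ hx := by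
    simpa only [inter_comm f] using h.minimal.symm.exists_inter_eq_singleton hf hx

lemma nonempty_left (h : IsObstruction A B S FA FB) (hB : 1 ≤ kB) : FA.Nonempty :=
  h.minimal.isUncolourable.nonempty_left fun f hf => card_pos.1 (h.isCrossing.card_right f hf ▸ hB)

lemma isTripleSystem {A B : LinearEquation 3} (h : IsObstruction A B S FA FB) :
    IsTripleSystem (IsSolutionEdge A B) S (FA ∪ FB) where
  isEdge := forall_mem_union.2 ⟨h.isCrossing.isEdge_left, h.isCrossing.isEdge_right⟩
  subset := forall_mem_union.2 ⟨h.subset_left, h.subset_right⟩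
  card_eq := forall_mem_union.2 ⟨h.isCrossing.card_left, h.isCrossing.card_right⟩
  cross := by
    refine forall_mem_union.2 ⟨fun e he x hx => ?_, fun f hf x hx => ?_⟩
    · obtain ⟨f, hf, hef⟩ := h.isCrossing.cross_left e he x hx
      exact ⟨f, mem_union_right _ hf, hef⟩
    · obtain ⟨e, he, hef⟩ := h.isCrossing.cross_right f hf x hx
      exact ⟨e, mem_union_left _ he, inter_comm e f ▸ hef⟩
  subset_of_closed _ hZ hin _ hg := h.minimal.subset_of_closed hZ hin hg
  uncolourable C := by
    rcases h.minimal.isUncolourable C with ⟨e, he, heC⟩ | ⟨f, hf, hfC⟩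
    · exact ⟨e, mem_union_left _ he, .inl (coe_subset.1 heC)⟩
    · exact ⟨f, mem_union_right _ hf,
        .inr (disjoint_coe.1 (Set.disjoint_left.2 fun _ hx => hfC hx))⟩

end IsObstruction

/-- The parameters of the crown exploration for equations of lengths `a` and `b`. -/
noncomputable def crownScheme (a b : ℕ) : Scheme where
  stepSize := a * (b - 1)
  stepEdges := b
  maxSize := a * b
  density := b / (a * ((b : ℝ) - 1))
  slack := 1 / ((b : ℝ) - 1)

lemma isCrownScheme_crownScheme {a b : ℕ} (ha : 3 ≤ a) (hab : a ≤ b) (hb : 4 ≤ b) :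
    IsCrownScheme (crownScheme a b) a b := by
  have ha' : (3 : ℝ) ≤ a := by exact_mod_cast ha
  have hb' : (4 : ℝ) ≤ b := by exact_mod_cast hb
  have hab' : (a : ℝ) ≤ b := by exact_mod_cast hab
  have hb1 : (0 : ℝ) < b - 1 := by linarith
  refine ⟨by omega, by omega, rfl, rfl, rfl, ?_, ?_, ?_, ?_, ?_, ?_⟩ <;> simp only [crownScheme]
  · field_simp
    ring
  · field_simp
  · positivity
  · rw [div_le_div_iff₀ hb1 (by norm_num)]
    linarith
  · rw [div_le_div_iff₀ (by positivity) (by norm_num)]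
    nlinarith
  · rw [div_le_div_iff₀ hb1 (by positivity)]
    nlinarith

/-- A scheme at the density of the threshold for equations of lengths `kA` and `kB`, whose local
steps keep the expected number of explorations bounded and by which every Rado set has a rare
exploration. -/
structure IsRadoScheme (P : Scheme) (kA kB : ℕ) : Prop where
  one_le_stepSize : 1 ≤ P.stepSize
  density_mul : P.density * P.stepSize = P.stepEdges
  slack_lt_one : P.slack < 1
  density_sub_one : P.density - 1 = -(((kA : ℝ) * kB - kA - kB) / ((kA : ℝ) * kB - kA))
  hasRareExploration : ∀ (A : LinearEquation kA) (B : LinearEquation kB) (S V : Finset ℤ) (L : ℕ),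
    IsRado A B (S : Set ℤ) → S ⊆ V → HasRareExploration P (IsSolutionEdge A B) V L S

lemma isRadoScheme_tripleScheme : IsRadoScheme tripleScheme 3 3 where
  one_le_stepSize := by norm_num [tripleScheme]
  density_mul := by norm_num [tripleScheme]
  slack_lt_one := by norm_num [tripleScheme]
  density_sub_one := by norm_num [tripleScheme]
  hasRareExploration _ _ _ _ _ hS hSV :=
    have ⟨_, _, hobs⟩ := hS.exists_isObstruction
    hobs.isTripleSystem.hasRareExploration hSV

lemma isRadoScheme_crownScheme (hA : 3 ≤ kA) (hAB : kA ≤ kB) (hB : 4 ≤ kB) :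
    IsRadoScheme (crownScheme kA kB) kA kB := by
  have hcrown := isCrownScheme_crownScheme hA hAB hB
  have ha : (kA : ℝ) ≠ 0 := by exact_mod_cast (by omega : kA ≠ 0)
  have hb : (0 : ℝ) < kB - 1 := sub_pos.2 (by exact_mod_cast (by omega : 1 < kB))
  refine ⟨Nat.mul_pos (by omega) (by omega), ?_, by linarith [hcrown.slack_le], ?_,
    fun A B S V L hS hSV => ?_⟩
  · simp only [crownScheme]
    rw [Nat.cast_mul, Nat.cast_sub (by omega), Nat.cast_one]
    field_simp
  · rw [crownScheme, show (kA : ℝ) * kB - kA = kA * (kB - 1) by ring]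
    field_simp
    ring
  · obtain ⟨FA, FB, hobs⟩ := hS.exists_isObstruction
    exact hobs.isCrossing.hasRareExploration hcrown (hobs.nonempty_left (by omega)) hSV

lemma exists_isRadoScheme (hA : 3 ≤ kA) (hAB : kA ≤ kB) : ∃ P, IsRadoScheme P kA kB := by
  rcases Nat.lt_or_ge kB 4 with hB | hB
  · obtain rfl : kB = 3 := by omega
    obtain rfl : kA = 3 := by omega
    exact ⟨_, isRadoScheme_tripleScheme⟩
  · exact ⟨_, isRadoScheme_crownScheme hA hAB hB⟩

lemma IsRadoScheme.randomSubset_isRado_le {P : Scheme} (hP : IsRadoScheme P kA kB) (n : ℕ)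
    (p : unitInterval) :
    randomSubset n p {S : Set ℤ | IsRado A B S} ≤
      setBernoulli (Icc (1 : ℤ) n : Set ℤ) p (rareSets P (IsSolutionEdge A B) (Icc (1 : ℤ) n)) := by
  rw [randomSubset, setBernoulli_apply_eq_apply_subsets, coe_Icc]
  refine MeasureTheory.measure_mono ?_
  rintro S ⟨hS, hSn⟩
  lift S to Finset ℤ using (Set.finite_Icc _ _).subset hSn
  exact ⟨S, Subset.rfl, hP.hasRareExploration A B S _ _ hS fun t ht => mem_Icc.2 (hSn ht)⟩

end Rado

theorem theorem1p5_general (kA kB : ℕ) (hA : 3 ≤ kA) (hAB : kA ≤ kB) :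
    ∃ c : ℝ, 0 < c ∧
      ∀ (A : LinearEquation kA) (B : LinearEquation kB) (p : ℕ → unitInterval),
        (∀ᶠ n : ℕ in atTop,
          (p n : ℝ) ≤ c * (n : ℝ) ^
            (-(((kA : ℝ) * kB - kA - kB) / ((kA : ℝ) * kB - kA)))) →
        Tendsto (fun n : ℕ => randomSubset n (p n) {S : Set ℤ | IsRado A B S})
          atTop (𝓝 0) := by
  obtain ⟨P, hP⟩ := exists_isRadoScheme hA hAB
  obtain ⟨c, hc, hsub⟩ :=
    exists_isSubcritical hP.density_mul hP.one_le_stepSize (completionBound kA kB)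
  refine ⟨c, hc, fun A B p hp => ?_⟩
  simp only [← hP.density_sub_one] at hp
  have hrare := tendsto_setBernoulli_rareSets (V := fun n => Icc (1 : ℤ) n)
    (hasCompletionBound_isSolutionEdge A B) (monotone_completionBound kA kB)
    (cast_completionBound kA kB) hsub hP.slack_lt_one (by simp) hp
  exact tendsto_of_tendsto_of_tendsto_of_le_of_le tendsto_const_nhds hrare (fun _ => zero_le)
    fun n => hP.randomSubset_isRado_le n (p n)

theorem theorem1p5 (kA kB : ℕ) (hA : 3 ≤ kA) (hAB : kA ≤ kB) :
    ∃ c : ℝ, 0 < c ∧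
      ∀ (A : LinearEquation kA) (B : LinearEquation kB),
        A.Irredundant → B.Irredundant →
        MatrixIrredundant A.underlyingMatrix → MatrixIrredundant B.underlyingMatrix →
        ∀ p : ℕ → unitInterval,
          (∀ᶠ n : ℕ in atTop,
            (p n : ℝ) ≤ c * (n : ℝ) ^
              (-(((kA : ℝ) * kB - kA - kB) / ((kA : ℝ) * kB - kA)))) →
          Tendsto (fun n : ℕ => randomSubset n (p n) {S : Set ℤ | IsRado A B S})
            atTop (𝓝 0) := by
  obtain ⟨c, hc, h⟩ := theorem1p5_general kA kB hA hAB
  exact ⟨c, hc, fun A B _ _ _ _ => h A B⟩
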